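/- Let $T>0$, $z\in\mathbb{R}$, and let $\alpha,\beta_T:[0,T]\to\mathbb{R}$ and $\gamma_T:[0,T)\to[0,\infty)$ be twice continuously differentiable functions with $\beta_T>0$ on $[0,T)$, $\beta_T(T)=\gamma_T(0)=0$, $\gamma_T$ strictly increasing, $\lim_{t\to T}\gamma_T(t)=\infty$ and $\lim_{t\to T}\beta_T(t)\gamma_T(t)=1$. Let $X=(X_u)_{u\in[0,T]}$ be the time-continuous Gauss--Markov bridge with these coefficients and $X_T=z$; that is, started from $x_0$ at time $0$, $$X_t=\alpha(t)+\beta_T(t)\Big((z-\alpha(T))\gamma_T(t)+B_{\gamma_T(t)}+\frac{x_0-\alpha(0)}{\beta_T(0)}\Big),\quad t\in[0,T),\qquad X_T=z,$$ for a standard Brownian motion $B$. For $t\in[0,T)$ and $x\in\mathbb{R}$, let $\mathsf{P}_{t,x}$ (with expectation $\mathsf{E}_{t,x}$) be the conditional law of $(X_u)_{u\in[t,T]}$ given $X_t=x$, in the version that is weakly continuous in $x$ and satisfies $\mathsf{P}_{t,x}(X_t=x)=1$. Put $$V_{T,z}(t,x)=\sup_{\tau\le T-t}\mathsf{E}_{t,x}[X_{t+\tau}],$$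 where $\tau$ runs over the stopping times, with values in $[0,T-t]$, of the natural filtration of $(X_{t+u})_{u\in[0,T-t]}$. Let $$G_{T,z}(s,y)=\alpha(\gamma_T^{-1}(s))+\beta_T(\gamma_T^{-1}(s))\big((z-\alpha(T))s+y\big),\qquad s\ge 0,\ y\in\mathbb{R},$$ and $$W_{T,z}(s,y)=\sup_{\sigma\ge0}\mathbb{E}_{s,y}\big[G_{T,z}(s+\sigma,Y_{s+\sigma})\big],$$ where, under $\mathbb{P}_{s,y}$, $Y_{s+u}=y+B_u$ for $u\ge 0$ with $B$ a standard Brownian motion (on any probability space), $\sigma$ runs over the $[0,\infty]$-valued stopping times of the natural filtration of $(Y_{s+u})_{u\ge0}$, and on $\{\sigma=\infty\}$ the gain is the almost sure limit $\lim_{u\to\infty}G_{T,z}(s+u,Y_{s+u})$. Let $(t,x)\in[0,T)\times\mathbb{R}$, $s=\gamma_T(t)$ and $y=(x-\alpha(t))/\beta_T(t)-\gamma_T(t)(z-\alpha(T))$. Then $$V_{T,z}(t,x)=W_{T,z}(s,y).$$ Moreover, under $\mathsf{P}_{t,x}$ there is a process $Y_{s+v}=y+B_v$, $v\ge0$, with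 $B$ a standard Brownian motion, such that $X_{t+u}=G_{T,z}(\gamma_T(t+u),Y_{\gamma_T(t+u)})$ for all $u\in[0,T-t)$, and for every random time $\tau^*$ with values in $[0,T-t]$: $\tau^*$ is an optimal stopping time for $V_{T,z}(t,x)$ (a stopping time that attains the supremum) if and only if $\sigma^*$, defined by $s+\sigma^*=\gamma_T(t+\tau^*)$ with the convention $\gamma_T(T)=\infty$, is an optimal stopping time for $W_{T,z}(s,y)$ with this process $Y$. -/

import Mathlib

open MeasureTheory ProbabilityTheory Filter Topology Set
open scoped NNReal

noncomputable section

namespace GMB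

/-- The coefficient functions of the Brownian representation of a Gauss--Markov bridge with
horizon `T`: `α` and `β` live on `[0, T]`, `γ` lives on `[0, T)`. -/
structure IsCoefficients (T : ℝ≥0) (α β γ : ℝ → ℝ) : Prop where
  horizon_pos : 0 < T
  contDiffOn_alpha : ContDiffOn ℝ 2 α (Icc 0 (T : ℝ))
  contDiffOn_beta : ContDiffOn ℝ 2 β (Icc 0 (T : ℝ))
  contDiffOn_gamma : ContDiffOn ℝ 2 γ (Ico 0 (T : ℝ))
  beta_pos : ∀ t ∈ Ico 0 (T : ℝ), 0 < β t
  beta_horizon : β T = 0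
  gamma_zero : γ 0 = 0
  strictMonoOn_gamma : StrictMonoOn γ (Ico 0 (T : ℝ))
  tendsto_gamma : Tendsto γ (𝓝[<] (T : ℝ)) atTop
  tendsto_beta_mul_gamma : Tendsto (fun t => β t * γ t) (𝓝[<] (T : ℝ)) (𝓝 1)

/-- Under `μ`, the process `X`, on the time interval `[0, T]`, is the Gauss--Markov bridge from
`(0, x₀)` to `(T, z)` with coefficients `α`, `β`, `γ`: a deterministic time-space transformation
of a standard Brownian motion. -/
def IsBridge {Ω : Type*} [MeasurableSpace Ω] (T : ℝ≥0) (z : ℝ) (α β γ : ℝ → ℝ) (x₀ : ℝ)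
    (X : ℝ≥0 → Ω → ℝ) (μ : Measure Ω) : Prop :=
  ∃ B : ℝ≥0 → Ω → ℝ, IsBrownianReal B μ ∧ ∀ᵐ ω ∂μ,
    (∀ t : ℝ≥0, t < T → X t ω =
      α t + β t * ((z - α T) * γ t + (B (γ t).toNNReal ω + (x₀ - α 0) / β 0))) ∧
    X T ω = z

/-- The Gauss--Markov bridge with `X_T = z` as a Markov family `(X, (P t x))`, `0 ≤ t < T`.
Under `P 0 x₀` the process `X` is the bridge from `(0, x₀)` to `(T, z)`, and for each `t` the
measures `P t x` are the regular conditional laws of `(X_u)_{t ≤ u ≤ T}` given `X_t = x`, in the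
version that satisfies `P t x (X_t = x) = 1` and is weakly continuous in `x` (which determines
the law of `(X_u)_{t ≤ u ≤ T}` under `P t x` for every `x`).
Only the times in `[0, T]` matter: the values `X u` for `u > T` are irrelevant. -/
structure IsBridgeFamily {Ω : Type*} [MeasurableSpace Ω] (T : ℝ≥0) (z : ℝ) (α β γ : ℝ → ℝ)
    (X : ℝ≥0 → Ω → ℝ) (P : ℝ≥0 → ℝ → Measure Ω) : Prop where
  measurable : ∀ u, Measurable (X u)
  isProbabilityMeasure : ∀ t < T, ∀ x, IsProbabilityMeasure (P t x)
  start : ∀ t < T, ∀ x, ∀ᵐ ω ∂(P t x), X t ω = x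
  continuous_paths : ∀ t < T, ∀ x, ∀ᵐ ω ∂(P t x), ContinuousOn (fun u => X u ω) (Icc t T)
  bridge : ∀ x₀, IsBridge T z α β γ x₀ X (P 0 x₀)
  conditional_law : ∀ t < T, ∀ x₀ : ℝ, ∀ C : Set ℝ, MeasurableSet C →
    ∀ A : Set (Icc t T → ℝ), MeasurableSet A →
      P 0 x₀ {ω | X t ω ∈ C ∧ (fun u : Icc t T => X u ω) ∈ A} =
        ∫⁻ x in C, P t x {ω | (fun u : Icc t T => X u ω) ∈ A} ∂((P 0 x₀).map (X t))
  weakly_continuous : ∀ t < T, ∀ I : Finset (Icc t T), ∀ f : BoundedContinuousFunction (I → ℝ) ℝ,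
    Continuous fun x => ∫ ω, f (fun u => X u.1 ω) ∂(P t x)

section Bridge

variable {Ω : Type*} [MeasurableSpace Ω] (T : ℝ≥0) (X : ℝ≥0 → Ω → ℝ) (hX : ∀ u, Measurable (X u))
  (t : ℝ≥0)

/-- `τ` is a `[0, T - t]`-valued stopping time of the process `(X_{t+u})_u`, with respect to the
natural filtration of that process. -/
def IsAdmissible (τ : Ω → ℝ≥0) : Prop :=
  IsStoppingTime (Filtration.natural (fun u => X (t + u)) fun u => (hX (t + u)).stronglyMeasurable)
      (fun ω => (τ ω : WithTop ℝ≥0)) ∧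
    ∀ ω, t + τ ω ≤ T

/-- The finite-horizon value: the supremum of `E[X_{t+τ}]` over the stopping times `τ ≤ T - t`.
(The running supremum of the Gaussian process `|X|` on `[t, T]` is integrable, so that all these
expectations are finite.) -/
def bridgeValue (μ : Measure Ω) : EReal :=
  ⨆ (τ : Ω → ℝ≥0) (_ : IsAdmissible T X hX t τ), ((∫ ω, X (t + τ ω) ω ∂μ : ℝ) : EReal)

/-- `τ` is an optimal stopping time for the finite-horizon problem. -/
def IsOptimalBridge (μ : Measure Ω) (τ : Ω → ℝ≥0) : Prop :=
  IsAdmissible T X hX t τ ∧ bridgeValue T X hX t μ = ((∫ ω, X (t + τ ω) ω ∂μ : ℝ) : EReal)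

end Bridge

/-- The gain function
`G (s, y) = α (γ⁻¹ s) + β (γ⁻¹ s) * ((z - α T) * s + y)`, with `γ⁻¹ : [0, ∞) → [0, T)`. -/
def gain (T : ℝ≥0) (z : ℝ) (α β γ : ℝ → ℝ) (s y : ℝ) : ℝ :=
  α (Function.invFunOn γ (Ico 0 (T : ℝ)) s) +
    β (Function.invFunOn γ (Ico 0 (T : ℝ)) s) * ((z - α T) * s + y)

/-- The gain `g (s + σ) Y_{s+σ}`, where `Y_{s+u} = y + B_u`. On `{σ = ∞}` it is the limit of
`g (s + u) Y_{s+u}` as `u → ∞`. -/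
def stoppedGain {Ω : Type*} (g : ℝ → ℝ → ℝ) (s y : ℝ) (B : ℝ≥0 → Ω → ℝ)
    (σ : Ω → WithTop ℝ≥0) (ω : Ω) : ℝ :=
  if σ ω = ⊤ then limUnder atTop (fun u : ℝ≥0 => g (s + u) (y + B u ω))
  else g (s + (σ ω).untopD 0) (y + B ((σ ω).untopD 0) ω)

section Brownian

variable {Ω : Type*} [MeasurableSpace Ω] (g : ℝ → ℝ → ℝ) (s y : ℝ) (B : ℝ≥0 → Ω → ℝ)
  (hB : ∀ u, Measurable (B u))

/-- `σ` is a `[0, ∞]`-valued stopping time of the process `Y_{s+u} = y + B_u`, with respect to the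
natural filtration of that process. -/
def IsBrownianStoppingTime (σ : Ω → WithTop ℝ≥0) : Prop :=
  IsStoppingTime (Filtration.natural (fun u ω => y + B u ω)
    fun u => ((hB u).const_add y).stronglyMeasurable) σ

/-- The infinite-horizon value: the supremum of `E[g (s + σ) Y_{s+σ}]` over the stopping times
`σ` of `Y_{s+u} = y + B_u`, the value `σ = ∞` being allowed. -/
def brownianValue (Q : Measure Ω) : EReal :=
  ⨆ (σ : Ω → WithTop ℝ≥0) (_ : IsBrownianStoppingTime y B hB σ),
    ((∫ ω, stoppedGain g s y B σ ω ∂Q : ℝ) : EReal)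

/-- `σ` is an optimal stopping time for the infinite-horizon problem. -/
def IsOptimalBrownian (Q : Measure Ω) (σ : Ω → WithTop ℝ≥0) : Prop :=
  IsBrownianStoppingTime y B hB σ ∧
    brownianValue g s y B hB Q = ((∫ ω, stoppedGain g s y B σ ω ∂Q : ℝ) : EReal)

end Brownian

/-- The relation `s + σ = γ (t + τ)` between random times, with the convention `γ T = ∞`. -/
def TimeLinked {Ω : Type*} (T : ℝ≥0) (γ : ℝ → ℝ) (t : ℝ≥0) (s : ℝ) (τ : Ω → ℝ≥0)
    (σ : Ω → WithTop ℝ≥0) : Prop :=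
  ∀ ω, (t + τ ω < T → ∃ r : ℝ≥0, σ ω = r ∧ s + r = γ (t + τ ω)) ∧ (t + τ ω = T → σ ω = ⊤)

end GMB

end

/-! The representation of the bridge can be inverted: reading `X` along the inverse of `γ` and
undoing the affine map gives a process `drive`. The Markov property of Brownian motion makes its
increments after `t` independent of `X t` under `P 0 x₀`. Hence for Lebesgue-almost every `x` they
have Brownian law under `P t x`, and weak continuity in `x` extends this to every `x`
(`eq_of_weakly_continuous`, `isBrownianReal_drive`).

The clock change `s + σ = γ (t + τ)` matches random times on the same space. It preserves natural
filtrations (`natural_bridge_eq`), hence stopping times (`isAdmissible_iff`), and it preserves gains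
(`bridge_eq_stoppedGain`); the end `T` of the bridge corresponds to `σ = ∞`, where path continuity
identifies the limit of the gain with `X T`. This settles everything for the Brownian motion
`drive`.

Independence of the value from the chosen Brownian motion is `brownianValue_le`. A stopping time is
rounded up to a dyadic grid, where it is a measurable functional of the path and can be copied to
any other Brownian motion; dominated convergence removes the rounding. The domination and the limit
at infinity come from an integrable linear growth bound and the law of large numbers, both derived
from a chaining estimate. -/

namespace GMB

/-! ### Chaining: the supremum of Brownian motion over dyadic times in `[0, 1]`. -/

/-- The fourth absolute moment of the standard Gaussian distribution. -/
noncomputable def fourthMoment : ENNReal := ∫⁻ x, ‖x‖ₑ ^ 4 ∂(gaussianReal 0 1)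

lemma fourthMoment_ne_top : fourthMoment ≠ ⊤ := by
  have h := (memLp_id_gaussianReal (μ := 0) (v := 1) 4).eLpNorm_lt_top
  have h2 := lintegral_rpow_enorm_lt_top_of_eLpNorm_lt_top (by simp) (by simp) h
  refine ne_of_lt (lt_of_eq_of_lt ?_ h2)
  simp only [fourthMoment, id]
  congr with x
  simp only [ENNReal.coe_ofNat, ENNReal.toReal_ofNat]
  exact_mod_cast (ENNReal.rpow_natCast _ 4).symm

lemma lintegral_pow_four_of_hasLaw {Ω : Type*} [MeasurableSpace Ω] {P : Measure Ω} {Y : Ω → ℝ}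
    {v : ℝ≥0} (hY : HasLaw Y (gaussianReal 0 v) P) :
    ∫⁻ ω, ‖Y ω‖ₑ ^ 4 ∂P = (v : ENNReal) ^ 2 * fourthMoment := by
  have h1 : gaussianReal 0 v = (gaussianReal 0 1).map (fun x => √(v : ℝ) * x) := by
    rw [gaussianReal_map_const_mul]
    congr 1
    · simp
    · ext; simp
  rw [hY.lintegral_comp (f := fun x => ‖x‖ₑ ^ 4) (by fun_prop), h1,
    lintegral_map (by fun_prop) (by fun_prop)]
  simp only [enorm_mul, mul_pow]
  rw [lintegral_const_mul _ (by fun_prop), fourthMoment]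
  congr 1
  have : ‖√(v : ℝ)‖ₑ ^ 2 = v := by
    rw [← enorm_pow, Real.sq_sqrt v.coe_nonneg]
    simp [← ofReal_norm]
  rw [← this]
  ring

/-- The supremum of `|W|` over the dyadic points of `[0, 1]`. -/
noncomputable def dyadicSup {Ω : Type*} (W : ℝ≥0 → Ω → ℝ) (ω : Ω) : ENNReal :=
  ⨆ n : ℕ, ⨆ k ∈ Finset.range (2 ^ n + 1), ‖W ((k : ℝ≥0) / 2 ^ n) ω‖ₑ

/-- The largest increment of `W` from a dyadic point of level `n` to the next point of level
`n + 1`. -/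
noncomputable def dyadicStep {Ω : Type*} (W : ℝ≥0 → Ω → ℝ) (n : ℕ) (ω : Ω) : ENNReal :=
  ⨆ k ∈ Finset.range (2 ^ n),
    ‖W (((2 * k + 1 : ℕ) : ℝ≥0) / 2 ^ (n + 1)) ω - W ((k : ℝ≥0) / 2 ^ n) ω‖ₑ

/-- Chaining: a point of level `n + 1` with even index already has level `n`; one with odd index
costs a single step from its left neighbour of level `n`. -/
lemma dyadicSup_le {Ω : Type*} (W : ℝ≥0 → Ω → ℝ) (ω : Ω) :
    dyadicSup W ω ≤ (‖W 0 ω‖ₑ + ‖W 1 ω‖ₑ) + ∑' n, dyadicStep W n ω := by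
  have key : ∀ n k : ℕ, k ≤ 2 ^ n → ‖W ((k : ℝ≥0) / 2 ^ n) ω‖ₑ ≤
      (‖W 0 ω‖ₑ + ‖W 1 ω‖ₑ) + ∑ i ∈ Finset.range n, dyadicStep W i ω := by
    intro n
    induction n with
    | zero =>
      intro k hk
      have : k = 0 ∨ k = 1 := by simp at hk; omega
      rcases this with rfl | rfl <;> simp
    | succ n ih =>
      intro k hk
      rw [Finset.sum_range_succ, ← add_assoc]
      rcases Nat.even_or_odd' k with ⟨j, rfl | rfl⟩
      · have hj : j ≤ 2 ^ n := by rw [pow_succ] at hk; omega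
        have e : (((2 * j : ℕ) : ℝ≥0) / 2 ^ (n + 1)) = (j : ℝ≥0) / 2 ^ n := by
          push_cast; rw [pow_succ]; field_simp
        rw [e]
        exact (ih j hj).trans le_self_add
      · have hj : j < 2 ^ n := by rw [pow_succ] at hk; omega
        set a := W (((2 * j + 1 : ℕ) : ℝ≥0) / 2 ^ (n + 1)) ω
        set b := W ((j : ℝ≥0) / 2 ^ n) ω with hb
        calc ‖a‖ₑ = ‖b + (a - b)‖ₑ := by congr 1; ring
          _ ≤ ‖b‖ₑ + ‖a - b‖ₑ := enorm_add_le _ _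
          _ ≤ _ := by
            gcongr
            · exact ih j hj.le
            · exact le_iSup₂_of_le (f := fun k (_ : k ∈ Finset.range (2 ^ n)) =>
                ‖W (((2 * k + 1 : ℕ) : ℝ≥0) / 2 ^ (n + 1)) ω - W ((k : ℝ≥0) / 2 ^ n) ω‖ₑ)
                j (Finset.mem_range.2 hj) le_rfl
  refine iSup_le fun n => iSup₂_le fun k hk => (key n k ?_).trans ?_
  · simpa [Nat.lt_succ_iff] using hk
  · gcongr
    exact ENNReal.sum_le_tsum _

/-- Turns a maximum of `2 ^ n` increments into a sum of fourth powers. Second moments would not do: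
the number of increments exactly offsets their variance. -/
lemma le_add_pow_four_div (x r : ENNReal) (hr : r ≠ 0) (hr' : r ≠ ⊤) : x ≤ r + x ^ 4 / r ^ 3 := by
  rcases le_total x r with h | h
  · exact h.trans le_self_add
  · refine le_trans ?_ le_add_self
    rw [ENNReal.le_div_iff_mul_le (by simp [hr]) (by simp [hr'])]
    calc x * r ^ 3 ≤ x * x ^ 3 := by gcongr
      _ = x ^ 4 := by ring

/-- A universal bound for the expectation of `dyadicSup`. -/
noncomputable def supConst : ENNReal :=
  (2 + 2 * fourthMoment) +
    ∑' n : ℕ, ((5 / 6 : ENNReal) ^ n + (108 / 125 : ENNReal) ^ n * fourthMoment)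

lemma supConst_ne_top : supConst ≠ ⊤ := by
  have geo : ∀ r : ENNReal, r < 1 → ∑' n : ℕ, r ^ n ≠ ⊤ := fun r hr => by
    rw [ENNReal.tsum_geometric]
    exact ENNReal.inv_ne_top.2 (tsub_pos_of_lt hr).ne'
  have h1 : (5 / 6 : ENNReal) < 1 :=
    (ENNReal.div_lt_iff (by simp) (by simp)).2 (by norm_num)
  have h2 : (108 / 125 : ENNReal) < 1 :=
    (ENNReal.div_lt_iff (by simp) (by simp)).2 (by norm_num)
  have h3 := fourthMoment_ne_top
  rw [supConst, ENNReal.tsum_add, ENNReal.tsum_mul_right]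
  refine ENNReal.add_ne_top.2 ⟨ENNReal.add_ne_top.2 ⟨by simp, ENNReal.mul_ne_top (by simp) h3⟩,
    ENNReal.add_ne_top.2 ⟨geo _ h1, ENNReal.mul_ne_top (geo _ h2) h3⟩⟩

section

variable {Ω : Type*} [MeasurableSpace Ω] {P : Measure Ω} {W : ℝ≥0 → Ω → ℝ}

lemma lintegral_dyadicStep_le (hW : IsPreBrownianReal W P) (n : ℕ) :
    ∫⁻ ω, dyadicStep W n ω ∂P ≤ (5 / 6 : ENNReal) ^ n + (108 / 125 : ENNReal) ^ n * fourthMoment := by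
  have := hW.isGaussianProcess.isProbabilityMeasure
  -- The threshold ratio must be less than `1` with cube greater than `1 / 2`, so that both series
  -- converge: `2 ^ n` fourth moments of order `4 ^ (-n)`, divided by `r ^ 3`, give `(1 / 2 * 216 /
  -- 125) ^ n = (108 / 125) ^ n`.
  set r : ENNReal := (5 / 6 : ENNReal) ^ n with hr
  have r0 : r ≠ 0 := by simp [hr, ENNReal.div_eq_zero_iff]
  have rt : r ≠ ⊤ := ENNReal.pow_ne_top (ENNReal.div_ne_top (by simp) (by simp))
  have hm : ∀ k : ℕ, AEMeasurable (fun ω =>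
      ‖W (((2 * k + 1 : ℕ) : ℝ≥0) / 2 ^ (n + 1)) ω - W ((k : ℝ≥0) / 2 ^ n) ω‖ₑ ^ 4) P :=
    fun k => (((hW.aemeasurable _).sub (hW.aemeasurable _)).enorm).pow_const 4
  have hp : ∀ ω, dyadicStep W n ω ≤ r + (∑ k ∈ Finset.range (2 ^ n),
      ‖W (((2 * k + 1 : ℕ) : ℝ≥0) / 2 ^ (n + 1)) ω - W ((k : ℝ≥0) / 2 ^ n) ω‖ₑ ^ 4) / r ^ 3 := by
    intro ω
    refine iSup₂_le fun k hk => (le_add_pow_four_div _ r r0 rt).trans ?_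
    gcongr
    exact Finset.single_le_sum (f := fun k : ℕ =>
      ‖W (((2 * k + 1 : ℕ) : ℝ≥0) / 2 ^ (n + 1)) ω - W ((k : ℝ≥0) / 2 ^ n) ω‖ₑ ^ 4)
      (fun _ _ => zero_le) hk
  refine (lintegral_mono hp).trans ?_
  rw [lintegral_add_left measurable_const, lintegral_const, measure_univ, mul_one]
  simp_rw [div_eq_mul_inv _ (r ^ 3), div_eq_mul_inv (108 : ENNReal)]
  rw [lintegral_mul_const'' _ (Finset.aemeasurable_fun_sum _ fun k _ => hm k),
    lintegral_finsetSum' _ fun k _ => hm k]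
  refine add_le_add le_rfl ?_
  have hk : ∀ k : ℕ, ∫⁻ ω, ‖W (((2 * k + 1 : ℕ) : ℝ≥0) / 2 ^ (n + 1)) ω -
      W ((k : ℝ≥0) / 2 ^ n) ω‖ₑ ^ 4 ∂P = ((2⁻¹ : ENNReal) ^ (n + 1)) ^ 2 * fourthMoment := by
    intro k
    have h := hW.hasLaw_sub (((2 * k + 1 : ℕ) : ℝ≥0) / 2 ^ (n + 1)) ((k : ℝ≥0) / 2 ^ n)
    have h' := lintegral_pow_four_of_hasLaw h
    simp only [Pi.sub_apply] at h'
    rw [h']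
    congr 2
    have e : nndist (((((2 * k + 1 : ℕ) : ℝ≥0) / 2 ^ (n + 1) : ℝ≥0) : ℝ))
        ((((k : ℝ≥0) / 2 ^ n : ℝ≥0) : ℝ)) = (2⁻¹ : ℝ≥0) ^ (n + 1) := by
      ext
      rw [coe_nndist, Real.dist_eq]
      push_cast
      have : ((2 * k + 1 : ℝ) / 2 ^ (n + 1) - k / 2 ^ n) = (2⁻¹ : ℝ) ^ (n + 1) := by
        rw [pow_succ, inv_pow]; field_simp; ring
      rw [this, abs_of_nonneg (by positivity)]
    erw [e]
    push_cast
    norm_num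
  simp only [hk, Finset.sum_const, Finset.card_range, nsmul_eq_mul]
  have hn : ((2 ^ n : ℕ) : ENNReal) * (((2⁻¹ : ENNReal) ^ (n + 1)) ^ 2) * (r ^ 3)⁻¹ ≤
      (108 * 125⁻¹ : ENNReal) ^ n := by
    have hr' : r = (((5 / 6 : ℝ≥0) ^ n : ℝ≥0) : ENNReal) := by
      rw [hr]; push_cast; rw [ENNReal.coe_div (by norm_num)]; norm_num
    have h108 : (108 * 125⁻¹ : ENNReal) = ((108 / 125 : ℝ≥0) : ENNReal) := by
      rw [ENNReal.coe_div (by norm_num), div_eq_mul_inv]; norm_num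
    have h2 : (2⁻¹ : ENNReal) = ((2⁻¹ : ℝ≥0) : ENNReal) := by
      rw [ENNReal.coe_inv (by norm_num)]; norm_num
    rw [hr', h108, h2, ← ENNReal.coe_pow, ← ENNReal.coe_pow, ← ENNReal.coe_pow,
      ← ENNReal.coe_inv (by positivity), ← ENNReal.coe_pow]
    norm_cast
    have e : ((2 ^ n : ℕ) : ℝ≥0) * ((2⁻¹ : ℝ≥0) ^ (n + 1)) ^ 2 * (((5 / 6 : ℝ≥0) ^ n) ^ 3)⁻¹
        = (108 / 125) ^ n * (1 / 4) := by
      have : (108 / 125 : ℝ≥0) = 2 * 2⁻¹ ^ 2 * ((5 / 6) ^ 3)⁻¹ := by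
        ext; push_cast; norm_num
      have a1 : ((2⁻¹ : ℝ≥0) ^ (n + 1)) ^ 2 = (2⁻¹ ^ 2) ^ n * 2⁻¹ ^ 2 := by
        rw [← pow_mul, ← pow_mul, add_mul, one_mul, pow_add, mul_comm n 2]
      have a2 : ((5 / 6 : ℝ≥0) ^ n) ^ 3 = ((5 / 6) ^ 3) ^ n := by
        rw [← pow_mul, ← pow_mul, mul_comm]
      rw [this, a1, a2, mul_pow, mul_pow, inv_pow ((5 / 6 : ℝ≥0) ^ 3)]
      have : (2⁻¹ : ℝ≥0) ^ 2 = 1 / 4 := by ext; push_cast; norm_num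
      rw [this]
      push_cast
      ring
    norm_cast at e
    rw [e]
    exact mul_le_of_le_one_right' (NNReal.coe_le_coe.1 (by push_cast; norm_num))
  calc _ = ((2 ^ n : ℕ) : ENNReal) * (((2⁻¹ : ENNReal) ^ (n + 1)) ^ 2) * (r ^ 3)⁻¹ *
        fourthMoment := by ring
    _ ≤ _ := by gcongr

/-- The expected supremum of a Brownian motion over the dyadic points of `[0, 1]` is finite. -/
lemma lintegral_dyadicSup_le (hW : IsPreBrownianReal W P) :
    ∫⁻ ω, dyadicSup W ω ∂P ≤ supConst := by
  have := hW.isGaussianProcess.isProbabilityMeasure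
  have hm : ∀ n, AEMeasurable (dyadicStep W n) P := fun n =>
    AEMeasurable.biSup _ (Finset.countable_toSet _) fun k _ =>
      ((hW.aemeasurable _).sub (hW.aemeasurable _)).enorm
  have h4 : ∀ v : ℝ≥0, v ≤ 1 → ∫⁻ ω, ‖W v ω‖ₑ ∂P ≤ 1 + fourthMoment := by
    intro v hv
    calc ∫⁻ ω, ‖W v ω‖ₑ ∂P ≤ ∫⁻ ω, (1 + ‖W v ω‖ₑ ^ 4) ∂P :=
          lintegral_mono fun ω => by
            simpa using le_add_pow_four_div ‖W v ω‖ₑ 1 (by simp) (by simp)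
      _ = 1 + (v : ENNReal) ^ 2 * fourthMoment := by
          rw [lintegral_add_left measurable_const, lintegral_const, measure_univ, mul_one,
            lintegral_pow_four_of_hasLaw (hW.hasLaw_eval v)]
      _ ≤ 1 + 1 * fourthMoment := by
          gcongr
          exact pow_le_one' (by exact_mod_cast hv) 2
      _ = _ := by rw [one_mul]
  refine (lintegral_mono (dyadicSup_le W)).trans ?_
  have h01 : AEMeasurable (fun ω => ‖W 0 ω‖ₑ + ‖W 1 ω‖ₑ) P :=
    (hW.aemeasurable 0).enorm.add (hW.aemeasurable 1).enorm
  rw [lintegral_add_left' h01,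
    lintegral_add_left' (hW.aemeasurable 0).enorm, lintegral_tsum hm, supConst]
  have e : 2 + 2 * fourthMoment = (1 + fourthMoment) + (1 + fourthMoment) := by ring
  rw [e]
  gcongr
  · exact h4 0 zero_le_one
  · exact h4 1 le_rfl
  · exact lintegral_dyadicStep_le hW _

lemma aemeasurable_dyadicSup (hW : ∀ u, AEMeasurable (W u) P) : AEMeasurable (dyadicSup W) P :=
  AEMeasurable.iSup fun _ => AEMeasurable.biSup _ (Finset.countable_toSet _) fun _ _ => (hW _).enorm

end

/-! ### Linear growth and the law of large numbers for Brownian motion. -/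

section

variable {Ω : Type*} {W : ℝ≥0 → Ω → ℝ}

/-- Continuity is required only at `u`, so this applies to the time inversion of a Brownian motion
without knowing its continuity at `0`. -/
lemma enorm_le_dyadicSup {ω : Ω} {u : ℝ≥0} (hu : u ≤ 1) (hc : ContinuousAt (fun v => W v ω) u) :
    ‖W u ω‖ₑ ≤ dyadicSup W ω := by
  have h1 : Tendsto (fun n : ℕ => ((⌊u * 2 ^ n⌋₊ : ℝ≥0) / 2 ^ n)) atTop (𝓝 u) := by
    rw [← NNReal.tendsto_coe]
    have h := (tendsto_nat_floor_mul_div_atTop (R := ℝ) (a := u) u.2).comp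
      (tendsto_pow_atTop_atTop_of_one_lt (one_lt_two (α := ℝ)))
    refine h.congr fun n => ?_
    simp only [Function.comp]
    push_cast
    congr 2
  have h2 := ((hc.tendsto.comp h1).enorm)
  refine le_of_tendsto h2 (Eventually.of_forall fun n => ?_)
  refine le_trans ?_ (le_iSup _ n)
  refine le_iSup₂_of_le (f := fun (k : ℕ) (_ : k ∈ Finset.range (2 ^ n + 1)) =>
    ‖W ((k : ℝ≥0) / 2 ^ n) ω‖ₑ) ⌊u * 2 ^ n⌋₊ (Finset.mem_range.2 ?_) le_rfl
  refine Nat.lt_succ_of_le (Nat.floor_le_of_le ?_)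
  push_cast
  exact mul_le_of_le_one_left' hu

lemma continuousAt_inversion {ω : Ω} (hc : Continuous fun v => W v ω) {v : ℝ≥0} (hv : v ≠ 0) :
    ContinuousAt (fun v : ℝ≥0 => (v : ℝ) * W (1 / v) ω) v := by
  have h1 : ContinuousAt (fun v : ℝ≥0 => 1 / v) v := by
    simp only [one_div]
    exact continuousAt_inv₀ hv
  exact (NNReal.continuous_coe.continuousAt).mul (hc.continuousAt.comp h1)

end

section

variable {Ω : Type*} [MeasurableSpace Ω] {Q : Measure Ω} {B : ℝ≥0 → Ω → ℝ}

/-- A Brownian motion grows at most linearly, with an integrable random constant. -/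
lemma exists_integrable_linear_bound (hB : IsBrownianReal B Q) :
    ∃ D : Ω → ℝ, Integrable D Q ∧ ∀ᵐ ω ∂Q, ∀ u : ℝ≥0, |B u ω| ≤ D ω * (1 + u) := by
  -- Time inversion carries `[1, ∞)` to `(0, 1]`, so two suprema over `[0, 1]` control all times.
  set V : ℝ≥0 → Ω → ℝ := fun v ω => v * B (1 / v) ω
  have hV : IsPreBrownianReal V Q := hB.toIsPreBrownianReal.inv
  have hm : AEMeasurable (fun ω => dyadicSup B ω + dyadicSup V ω) Q :=
    (aemeasurable_dyadicSup hB.aemeasurable).add (aemeasurable_dyadicSup hV.aemeasurable)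
  have hfin : ∫⁻ ω, (dyadicSup B ω + dyadicSup V ω) ∂Q ≠ ⊤ := by
    rw [lintegral_add_left' (aemeasurable_dyadicSup hB.aemeasurable)]
    exact ENNReal.add_ne_top.2
      ⟨ne_top_of_le_ne_top supConst_ne_top (lintegral_dyadicSup_le hB.toIsPreBrownianReal),
        ne_top_of_le_ne_top supConst_ne_top (lintegral_dyadicSup_le hV)⟩
  refine ⟨_, integrable_toReal_of_lintegral_ne_top hm hfin, ?_⟩
  filter_upwards [ae_lt_top' hm hfin, hB.cont] with ω hω hc u
  have hD := ENNReal.toReal_nonneg (a := dyadicSup B ω + dyadicSup V ω)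
  have hle : ∀ r : ℝ, ‖r‖ₑ ≤ dyadicSup B ω + dyadicSup V ω →
      |r| ≤ (dyadicSup B ω + dyadicSup V ω).toReal := fun r hr => by
    simpa using ENNReal.toReal_mono hω.ne hr
  rcases le_total u 1 with hu | hu
  · have h := hle _ ((enorm_le_dyadicSup (W := B) hu hc.continuousAt).trans le_self_add)
    nlinarith [u.coe_nonneg]
  · have hu0 : u ≠ 0 := (zero_lt_one.trans_le hu).ne'
    have hu' : (0 : ℝ) < u := by positivity
    have h := hle _ ((enorm_le_dyadicSup (W := V) (u := u⁻¹) (inv_le_one_of_one_le₀ hu)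
      (continuousAt_inversion hc (inv_ne_zero hu0))).trans le_add_self)
    have e : V u⁻¹ ω = (u : ℝ)⁻¹ * B u ω := by simp [V]
    rw [e, abs_mul, abs_inv, abs_of_pos hu'] at h
    rw [inv_mul_le_iff₀ hu'] at h
    nlinarith

/-- The strong law of large numbers for Brownian motion. -/
lemma tendsto_div_one_add (hB : IsBrownianReal B Q) :
    ∀ᵐ ω ∂Q, Tendsto (fun u : ℝ≥0 => B u ω / (1 + u)) atTop (𝓝 0) := by
  set V : ℝ≥0 → Ω → ℝ := fun v ω => v * B (1 / v) ω
  have hV : IsPreBrownianReal V Q := hB.toIsPreBrownianReal.inv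
  set c : ℕ → ℝ≥0 := fun N => 1 / (N + 1 : ℝ≥0)
  have hc0 : ∀ N, c N ≠ 0 := fun N => by positivity
  -- Since `B u / u = V (1 / u)`, the supremum of `|V|` near `0` is needed. By Brownian scaling, the
  -- one over `[0, c N]` is `√(c N)` times a supremum over `[0, 1]`, whose mean is bounded uniformly
  -- in `N`.
  set U : ℕ → ℝ≥0 → Ω → ℝ := fun N v ω => (√(c N : ℝ))⁻¹ * V (c N * v) ω
  have hU : ∀ N, IsPreBrownianReal (U N) Q := fun N => hV.smul (hc0 N)
  set F : ℕ → Ω → ENNReal := fun N ω => ‖√(c N : ℝ)‖ₑ * dyadicSup (U N) ω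
  have hF : ∀ N, ∫⁻ ω, F N ω ∂Q ≤ ‖√(c N : ℝ)‖ₑ * supConst := fun N => by
    rw [lintegral_const_mul'' _ (aemeasurable_dyadicSup (hU N).aemeasurable)]
    gcongr
    exact lintegral_dyadicSup_le (hU N)
  have hFm : ∀ N, AEMeasurable (F N) Q := fun N =>
    (aemeasurable_dyadicSup (hU N).aemeasurable).const_mul _
  have hlim : Tendsto (fun N => ‖√(c N : ℝ)‖ₑ * supConst) atTop (𝓝 0) := by
    have h1 : Tendsto (fun N => √(c N : ℝ)) atTop (𝓝 0) := by
      have : Tendsto (fun N : ℕ => (c N : ℝ)) atTop (𝓝 0) := by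
        simpa [c] using tendsto_one_div_add_atTop_nhds_zero_nat (𝕜 := ℝ)
      simpa using this.sqrt
    have h2 := ENNReal.Tendsto.mul_const (b := supConst) h1.enorm (Or.inr supConst_ne_top)
    simpa using h2
  -- The means tend to `0`, so the infimum over `N` vanishes almost surely. This suffices, because a
  -- small `F N` controls all times `u ≥ N + 1` at once.
  have hzero : ∫⁻ ω, ⨅ N, F N ω ∂Q = 0 := le_antisymm
    (ge_of_tendsto' hlim fun N => (lintegral_mono fun ω => iInf_le _ N).trans (hF N)) zero_le
  rw [lintegral_eq_zero_iff' (AEMeasurable.iInf hFm)] at hzero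
  filter_upwards [hzero, hB.cont] with ω hω hc
  have hω' : ⨅ N, F N ω = 0 := hω
  rw [tendsto_zero_iff_enorm_tendsto_zero, ENNReal.tendsto_nhds_zero]
  intro ε hε
  obtain ⟨N, hN⟩ := iInf_lt_iff.1 (hω'.trans_lt hε)
  filter_upwards [eventually_ge_atTop (N + 1 : ℝ≥0)] with u hu
  refine le_trans ?_ hN.le
  have hu0 : u ≠ 0 := ((by positivity : (0 : ℝ≥0) < N + 1).trans_le hu).ne'
  have hu' : (0 : ℝ) < u := by positivity
  have hv : (N + 1 : ℝ≥0) * u⁻¹ ≤ 1 := by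
    rw [← div_eq_mul_inv]; exact div_le_one_of_le₀ hu zero_le
  have hcv : c N * ((N + 1 : ℝ≥0) * u⁻¹) = u⁻¹ := by
    simp only [c]; field_simp
  have hcont : ContinuousAt (fun v => U N v ω) ((N + 1 : ℝ≥0) * u⁻¹) := by
    have h1 : ContinuousAt (fun v => V v ω) (c N * ((N + 1 : ℝ≥0) * u⁻¹)) := by
      rw [hcv]; exact continuousAt_inversion hc (inv_ne_zero hu0)
    have h2 : ContinuousAt (fun v : ℝ≥0 => c N * v) ((N + 1 : ℝ≥0) * u⁻¹) := by fun_prop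
    exact continuousAt_const.mul (h1.comp_of_eq h2 rfl)
  have h := enorm_le_dyadicSup hv hcont
  calc ‖B u ω / (1 + u)‖ₑ ≤ ‖B u ω / u‖ₑ := by
        have h1u : (0 : ℝ) < 1 + u := by positivity
        rw [enorm_le_iff_norm_le, norm_div, norm_div, Real.norm_of_nonneg hu'.le,
          Real.norm_of_nonneg h1u.le]
        gcongr
        linarith
    _ = ‖√(c N : ℝ) * U N ((N + 1 : ℝ≥0) * u⁻¹) ω‖ₑ := by
        congr 1
        simp only [U, hcv]
        rw [mul_inv_cancel_left₀ (by have := hc0 N; positivity)]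
        simp only [V, one_div, inv_inv, NNReal.coe_inv]
        rw [div_eq_inv_mul]
    _ ≤ F N ω := by
        rw [enorm_mul]
        simp only [F]
        gcongr

end

/-! ### The infinite-horizon value depends only on the law of Brownian motion. -/

/-- Two Brownian motions, possibly on different spaces, have the same law on path space. -/
lemma map_path_eq {Ω Ω' : Type*} [MeasurableSpace Ω] [MeasurableSpace Ω'] {P : Measure Ω}
    {Q : Measure Ω'} {B : ℝ≥0 → Ω → ℝ} {B' : ℝ≥0 → Ω' → ℝ} (hB : IsPreBrownianReal B P)
    (hB' : IsPreBrownianReal B' Q) (hm : ∀ u, Measurable (B u)) (hm' : ∀ u, Measurable (B' u)) :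
    P.map (fun ω u => B u ω) = Q.map (fun ω u => B' u ω) := by
  have := hB.isGaussianProcess.isProbabilityMeasure
  have h1 := isProjectiveLimit_map (P := P) (X := B) (measurable_pi_lambda _ hm).aemeasurable
  have h2 := isProjectiveLimit_map (P := Q) (X := B') (measurable_pi_lambda _ hm').aemeasurable
  have e1 : (fun I : Finset ℝ≥0 => P.map (fun ω => I.restrict (B · ω))) =
      BrownianReal.projectiveFamily := funext fun I => (hB.hasLaw I).map_eq
  have e2 : (fun I : Finset ℝ≥0 => Q.map (fun ω => I.restrict (B' · ω))) =
      BrownianReal.projectiveFamily := funext fun I => (hB'.hasLaw I).map_eq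
  rw [e1] at h1
  rw [e2] at h2
  exact h1.unique h2

/-- The dyadic point `k / 2 ^ n`. -/
noncomputable def grid (n k : ℕ) : ℝ≥0 := k / 2 ^ n

lemma grid_mono (n : ℕ) : Monotone (grid n) := fun _ _ h => by
  unfold grid
  gcongr

open Classical in
/-- The first point of level `n` at which `p` holds. -/
noncomputable def firstGrid (n : ℕ) (p : ℕ → Prop) : WithTop ℝ≥0 :=
  if h : ∃ k, p k then ((grid n (Nat.find h) : ℝ≥0) : WithTop ℝ≥0) else ⊤

lemma firstGrid_le_iff {n : ℕ} {p : ℕ → Prop} {r : ℝ≥0} :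
    firstGrid n p ≤ (r : WithTop ℝ≥0) ↔ ∃ k, p k ∧ grid n k ≤ r := by
  classical
  unfold firstGrid
  split_ifs with h
  · rw [WithTop.coe_le_coe]
    exact ⟨fun hr => ⟨_, Nat.find_spec h, hr⟩,
      fun ⟨k, hk, hr⟩ => (grid_mono n (Nat.find_min' h hk)).trans hr⟩
  · simp only [top_le_iff, WithTop.coe_ne_top, false_iff]
    exact fun ⟨k, hk, _⟩ => h ⟨k, hk⟩

lemma firstGrid_eq_top {n : ℕ} {p : ℕ → Prop} (h : ∀ k, ¬ p k) : firstGrid n p = ⊤ := by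
  unfold firstGrid
  rw [dif_neg (not_exists.2 h)]

lemma firstGrid_eq_coe (n : ℕ) {p : ℕ → Prop} (h : ∃ k, p k) :
    ∃ k, firstGrid n p = (grid n k : ℝ≥0) ∧ p k ∧ ∀ m, p m → k ≤ m := by
  classical
  exact ⟨Nat.find h, by rw [firstGrid, dif_pos h], Nat.find_spec h,
    fun m hm => Nat.find_min' h hm⟩

lemma firstGrid_coe (n : ℕ) (v : ℝ≥0) : ∃ r : ℝ≥0,
    firstGrid n (fun k => (v : WithTop ℝ≥0) ≤ (grid n k : ℝ≥0)) = r ∧ v ≤ r ∧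
      r ≤ v + (1 / 2) ^ n := by
  have h2 : (0 : ℝ≥0) < 2 ^ n := by positivity
  have hceil : (v : WithTop ℝ≥0) ≤ (grid n ⌈v * 2 ^ n⌉₊ : ℝ≥0) := by
    refine WithTop.coe_le_coe.2 ?_
    rw [grid, le_div_iff₀ h2]
    exact Nat.le_ceil _
  obtain ⟨k, hk, hvk, hmin⟩ := firstGrid_eq_coe n
    (p := fun k => (v : WithTop ℝ≥0) ≤ (grid n k : ℝ≥0)) ⟨_, hceil⟩
  refine ⟨_, hk, WithTop.coe_le_coe.1 hvk, (grid_mono n (hmin _ hceil)).trans ?_⟩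
  rw [grid, div_le_iff₀ h2, add_mul, ← mul_pow]
  have : (1 / 2 : ℝ≥0) * 2 = 1 := by norm_num
  rw [this, one_pow]
  exact (Nat.ceil_lt_add_one zero_le).le

section

variable {g : ℝ → ℝ → ℝ} {s y z C : ℝ}

/-- The gain stopped at a first dyadic point is a measurable functional of the path, once the gain
at infinity is replaced by a constant. -/
lemma exists_measurable_stoppedGain
    (hg : Continuous fun p : ℝ≥0 × ℝ => g (s + p.1) (y + p.2)) (n : ℕ)
    (p : ℕ → (ℝ≥0 → ℝ) → Prop) (hp : ∀ k, MeasurableSet {w | p k w}) :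
    ∃ Ψ : (ℝ≥0 → ℝ) → ℝ, Measurable Ψ ∧
      ∀ w, Tendsto (fun u : ℝ≥0 => g (s + u) (y + w u)) atTop (𝓝 z) →
        stoppedGain g s y (fun u w => w u) (fun w => firstGrid n (p · w)) w = Ψ w := by
  classical
  -- The second alternative makes the search total: if no `p k w` holds it ends at `0`, where the
  -- test `p` fails and the constant `z` is returned.
  have hex : ∀ w, ∃ k, p k w ∨ ∀ m, ¬ p m w := fun w => by
    by_cases h : ∃ k, p k w
    · exact h.imp fun k => Or.inl
    · exact ⟨0, Or.inr (not_exists.1 h)⟩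
  have hall : MeasurableSet {w | ∀ m, ¬ p m w} := by
    simp only [ofPred_forall]
    exact MeasurableSet.iInter fun m => (hp m).compl
  refine ⟨fun w => if p (Nat.find (hex w)) w then
    g (s + grid n (Nat.find (hex w))) (y + w (grid n (Nat.find (hex w)))) else z, ?_, ?_⟩
  · refine Measurable.find (f := fun k w => if p k w then
      g (s + grid n k) (y + w (grid n k)) else z) (fun k => ?_)
      (p := fun k w => p k w ∨ ∀ m, ¬ p m w) (fun k => (hp k).union hall) hex
    refine Measurable.ite (hp k) ?_ measurable_const
    have h1 : Continuous fun b : ℝ => g (s + grid n k) (y + b) :=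
      hg.comp (continuous_const.prodMk continuous_id)
    exact h1.measurable.comp (measurable_pi_apply _)
  · intro w hw
    by_cases h : ∃ k, p k w
    · have hs := Nat.find_spec (hex w)
      have hp1 : p (Nat.find (hex w)) w := hs.resolve_right fun hn => h.elim fun k hk => hn k hk
      obtain ⟨k, hk, hpk, hmin⟩ := firstGrid_eq_coe n h
      have heq : Nat.find (hex w) = k := le_antisymm
        (Nat.find_min' _ (Or.inl hpk)) (hmin _ hp1)
      simp only [stoppedGain, hk, WithTop.coe_ne_top, if_false, heq, WithTop.untopD_coe]
      rw [if_pos hpk]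
    · simp only [stoppedGain, firstGrid_eq_top (not_exists.1 h), if_true]
      rw [if_neg fun hk => h ⟨_, hk⟩]
      exact hw.limUnder_eq

variable {Ω Ω' : Type*} [MeasurableSpace Ω] [MeasurableSpace Ω'] {P : Measure Ω} {Q : Measure Ω'}
  {B : ℝ≥0 → Ω → ℝ} {B' : ℝ≥0 → Ω' → ℝ}

/-- Transported to another Brownian motion, the events given by `A k` need not increase with `k`.
The first index that succeeds still gives a stopping time, since each `A k` sees the path only up to
`grid n k`. -/
lemma isBrownianStoppingTime_firstGrid (hB : ∀ u, Measurable (B u)) (n : ℕ)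
    {A : ∀ k : ℕ, Set (Iic (grid n k) → ℝ)} (hA : ∀ k, MeasurableSet (A k)) :
    IsBrownianStoppingTime y B hB
      (fun ω => firstGrid n fun k => (fun j : Iic (grid n k) => y + B j ω) ∈ A k) := by
  intro r
  simp only [firstGrid_le_iff, ofPred_exists]
  refine MeasurableSet.iUnion fun k => ?_
  by_cases hk : grid n k ≤ r
  · simp only [hk, and_true]
    refine Filtration.mono _ hk _ ?_
    rw [Filtration.natural_eq_comap]
    exact ⟨A k, hA k, rfl⟩
  · simp only [hk, and_false, ofPred_false]
    exact @MeasurableSet.empty Ω (Filtration.natural (fun u ω => y + B u ω)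
      (fun u => ((hB u).const_add y).stronglyMeasurable) r)

/-- The value of the infinite-horizon problem does not depend on the Brownian motion. -/
lemma brownianValue_le
    (hg : Continuous fun p : ℝ≥0 × ℝ => g (s + p.1) (y + p.2))
    (hC : ∀ (u : ℝ≥0) (b : ℝ), |g (s + u) (y + b)| ≤ C * (1 + |b| / (1 + u)))
    (hz : ∀ b : ℝ≥0 → ℝ, Tendsto (fun u : ℝ≥0 => b u / (1 + u)) atTop (𝓝 0) →
      Tendsto (fun u : ℝ≥0 => g (s + u) (y + b u)) atTop (𝓝 z))
    (hB : ∀ u, Measurable (B u)) (hB' : ∀ u, Measurable (B' u))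
    (hP : IsBrownianReal B P) (hQ : IsBrownianReal B' Q) :
    brownianValue g s y B' hB' Q ≤ brownianValue g s y B hB P := by
  have := hQ.isGaussianProcess.isProbabilityMeasure
  refine iSup₂_le fun σ hσ => ?_
  -- In the natural filtration, `σ ≤ grid n k` is a measurable condition on the path up to that
  -- time; the same condition can then be imposed on the path of `B`.
  have hex : ∀ n k, ∃ A : Set (Iic (grid n k) → ℝ), MeasurableSet A ∧
      ∀ ω, (fun j : Iic (grid n k) => y + B' j ω) ∈ A ↔ σ ω ≤ (grid n k : ℝ≥0) := by
    intro n k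
    have h := hσ (grid n k)
    rw [Filtration.natural_eq_comap] at h
    obtain ⟨A, hA, hAeq⟩ := h
    exact ⟨A, hA, fun ω => Set.ext_iff.1 hAeq ω⟩
  choose A hA hAσ using hex
  set p : ℕ → ℕ → (ℝ≥0 → ℝ) → Prop := fun n k w =>
    (fun j : Iic (grid n k) => y + w j) ∈ A n k
  have hpm : ∀ n k, MeasurableSet {w | p n k w} := fun n k =>
    (measurable_pi_lambda (fun (w : ℝ≥0 → ℝ) (j : Iic (grid n k)) => y + w j)
      fun j => measurable_const.add (measurable_pi_apply (j : ℝ≥0))) (hA n k)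
  choose Ψ hΨ hΨeq using fun n => exists_measurable_stoppedGain (z := z) hg n (p n) (hpm n)
  set ρ : ℕ → Ω → WithTop ℝ≥0 := fun n ω => firstGrid n fun k => p n k fun u => B u ω
  set ρ' : ℕ → Ω' → WithTop ℝ≥0 := fun n ω => firstGrid n fun k => p n k fun u => B' u ω
  have hlim : ∀ᵐ ω ∂P, Tendsto (fun u : ℝ≥0 => g (s + u) (y + B u ω)) atTop (𝓝 z) := by
    filter_upwards [tendsto_div_one_add hP] with ω hω using hz _ hω
  have hlim' : ∀ᵐ ω ∂Q, Tendsto (fun u : ℝ≥0 => g (s + u) (y + B' u ω)) atTop (𝓝 z) := by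
    filter_upwards [tendsto_div_one_add hQ] with ω hω using hz _ hω
  have e1 : ∀ n, stoppedGain g s y B (ρ n) =ᵐ[P] fun ω => Ψ n fun u => B u ω := fun n => by
    filter_upwards [hlim] with ω hω using hΨeq n (fun u => B u ω) hω
  have e2 : ∀ n, stoppedGain g s y B' (ρ' n) =ᵐ[Q] fun ω => Ψ n fun u => B' u ω := fun n => by
    filter_upwards [hlim'] with ω hω using hΨeq n (fun u => B' u ω) hω
  have hint : ∀ n, ∫ ω, stoppedGain g s y B' (ρ' n) ω ∂Q = ∫ ω, stoppedGain g s y B (ρ n) ω ∂P := by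
    intro n
    rw [integral_congr_ae (e1 n), integral_congr_ae (e2 n),
      ← integral_map (φ := fun ω u => B' u ω) (measurable_pi_lambda _ hB').aemeasurable
        (hΨ n).aestronglyMeasurable,
      ← integral_map (φ := fun ω u => B u ω) (measurable_pi_lambda _ hB).aemeasurable
        (hΨ n).aestronglyMeasurable,
      map_path_eq hP.toIsPreBrownianReal hQ.toIsPreBrownianReal hB hB']
  obtain ⟨D, hD, hDle⟩ := exists_integrable_linear_bound hQ
  have hC0 : 0 ≤ C := by
    have := (abs_nonneg _).trans (hC 0 0)
    simpa using this
  have htend : Tendsto (fun n => ∫ ω, stoppedGain g s y B' (ρ' n) ω ∂Q) atTop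
      (𝓝 (∫ ω, stoppedGain g s y B' σ ω ∂Q)) := by
    -- The first term of the bound covers finite stopping times, through the linear growth of the
    -- path; `|z|` covers the gain at infinity.
    refine tendsto_integral_of_dominated_convergence (fun ω => C * (1 + D ω) + |z|)
      (fun n => ?_) ?_ (fun n => ?_) ?_
    · exact ((hΨ n).comp (measurable_pi_lambda _ hB')).aestronglyMeasurable.congr (e2 n).symm
    · exact (((integrable_const 1).add hD).const_mul C).add (integrable_const _)
    · filter_upwards [hDle, hlim'] with ω h1 h2
      have hb : ∀ u : ℝ≥0, |g (s + u) (y + B' u ω)| ≤ C * (1 + D ω) := fun u => by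
        refine (hC u _).trans ?_
        gcongr
        rw [div_le_iff₀ (by positivity)]
        exact h1 u
      unfold stoppedGain
      split_ifs with h
      · rw [h2.limUnder_eq, Real.norm_eq_abs]
        have := (abs_nonneg _).trans (hb 0)
        linarith
      · rw [Real.norm_eq_abs]
        have := hb ((ρ' n ω).untopD 0)
        linarith [abs_nonneg z]
    · filter_upwards [hQ.cont] with ω hc
      have hρ : ∀ n, ρ' n ω = firstGrid n fun k => σ ω ≤ (grid n k : ℝ≥0) := fun n => by
        simp only [ρ', p, hAσ]
      -- Rounding up leaves `∞` unchanged and moves a finite value by at most `(1 / 2) ^ n`, so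
      -- continuity of the path and of the gain gives the limit.
      rcases hv : σ ω with _ | v
      · have : ∀ n, ρ' n ω = ⊤ := fun n => by
          rw [hρ n]
          refine firstGrid_eq_top fun k => ?_
          rw [hv]
          exact fun h => WithTop.coe_ne_top (top_le_iff.1 h)
        have hv' : σ ω = ⊤ := hv
        simp only [stoppedGain, this, hv', if_true]
        exact tendsto_const_nhds
      · have hv' : σ ω = (v : WithTop ℝ≥0) := hv
        choose r hr hvr hrv using fun n => firstGrid_coe n v
        have hρr : ∀ n, ρ' n ω = r n := fun n => by rw [hρ n, hv', hr n]
        simp only [stoppedGain, hρr, hv', WithTop.coe_ne_top, if_false, WithTop.untopD_coe]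
        have hrt : Tendsto r atTop (𝓝 v) := by
          refine tendsto_of_tendsto_of_tendsto_of_le_of_le tendsto_const_nhds ?_ hvr hrv
          have : Tendsto (fun n : ℕ => (1 / 2 : ℝ≥0) ^ n) atTop (𝓝 0) :=
            NNReal.tendsto_pow_atTop_nhds_zero_of_lt_one (by norm_num)
          simpa using this.const_add v
        have h3 := (hg.tendsto (v, B' v ω)).comp
          (hrt.prodMk_nhds ((hc.tendsto v).comp hrt))
        exact h3
  refine le_of_tendsto ((continuous_coe_real_ereal.tendsto _).comp htend)
    (Eventually.of_forall fun n => ?_)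
  simp only [Function.comp]
  rw [hint n]
  exact le_iSup₂_of_le (ρ n) (isBrownianStoppingTime_firstGrid hB n (hA n)) le_rfl

end

/-! ### The inverse clock and the asymptotics of the gain. -/

lemma exists_abs_le_of_tendsto {f : ℝ≥0 → ℝ} {l : ℝ} (hf : Continuous f)
    (hl : Tendsto f atTop (𝓝 l)) : ∃ C, ∀ u, |f u| ≤ C := by
  obtain ⟨N, hN⟩ := eventually_atTop.1 (hl.abs.eventually (ge_mem_nhds (lt_add_one |l|)))
  obtain ⟨C, hC⟩ := (isCompact_Icc (a := (0 : ℝ≥0)) (b := N)).exists_bound_of_continuousOn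
    hf.continuousOn
  refine ⟨max C (|l| + 1), fun u => ?_⟩
  rcases le_total u N with h | h
  · exact (hC u ⟨zero_le, h⟩).trans (le_max_left _ _)
  · exact (hN u h).trans (le_max_right _ _)

/-- The time at which the clock `γ`, started at `s`, has run for the duration `v`. -/
noncomputable def clock (T : ℝ≥0) (γ : ℝ → ℝ) (s : ℝ) (v : ℝ≥0) : ℝ :=
  Function.invFunOn γ (Ico 0 (T : ℝ)) (s + v)

namespace IsCoefficients

variable {T : ℝ≥0} {α β γ : ℝ → ℝ} {z s y : ℝ}

lemma surjOn_gamma (h : IsCoefficients T α β γ) : SurjOn γ (Ico 0 (T : ℝ)) (Ici 0) := by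
  have hT : (0 : ℝ) < T := h.horizon_pos
  have h1 := isPreconnected_Ico.intermediate_value_Ici (s := Ico 0 (T : ℝ)) (a := 0)
    (l := 𝓝[<] (T : ℝ)) ⟨le_rfl, hT⟩ (le_principal_iff.2 (Ico_mem_nhdsLT hT))
    h.contDiffOn_gamma.continuousOn h.tendsto_gamma
  rwa [h.gamma_zero] at h1

lemma gamma_nonneg (h : IsCoefficients T α β γ) {r : ℝ} (hr : r ∈ Ico 0 (T : ℝ)) : 0 ≤ γ r := by
  rw [← h.gamma_zero]
  exact h.strictMonoOn_gamma.monotoneOn ⟨le_rfl, hr.1.trans_lt hr.2⟩ hr hr.1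

lemma clock_mem (h : IsCoefficients T α β γ) (hs : 0 ≤ s) (v : ℝ≥0) :
    clock T γ s v ∈ Ico 0 (T : ℝ) :=
  Function.invFunOn_mem (h.surjOn_gamma (add_nonneg hs v.2))

lemma clock_mem_Icc (h : IsCoefficients T α β γ) (hs : 0 ≤ s) (v : ℝ≥0) :
    clock T γ s v ∈ Icc 0 (T : ℝ) :=
  Ico_subset_Icc_self (h.clock_mem hs v)

lemma gamma_clock (h : IsCoefficients T α β γ) (hs : 0 ≤ s) (v : ℝ≥0) :
    γ (clock T γ s v) = s + v :=
  Function.invFunOn_eq (h.surjOn_gamma (add_nonneg hs v.2))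

lemma clock_eq (h : IsCoefficients T α β γ) (hs : 0 ≤ s) {v : ℝ≥0} {r : ℝ}
    (hr : r ∈ Ico 0 (T : ℝ)) (hrv : γ r = s + v) : clock T γ s v = r :=
  h.strictMonoOn_gamma.injOn (h.clock_mem hs v) hr ((h.gamma_clock hs v).trans hrv.symm)

lemma strictMono_clock (h : IsCoefficients T α β γ) (hs : 0 ≤ s) : StrictMono (clock T γ s) := by
  intro u v huv
  rw [← h.strictMonoOn_gamma.lt_iff_lt (h.clock_mem hs u) (h.clock_mem hs v),
    h.gamma_clock hs, h.gamma_clock hs]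
  have : (u : ℝ) < v := huv
  linarith

lemma lt_clock_iff (h : IsCoefficients T α β γ) (hs : 0 ≤ s) {v : ℝ≥0} {r : ℝ}
    (hr : r ∈ Ico 0 (T : ℝ)) : r < clock T γ s v ↔ γ r < s + v := by
  rw [← h.gamma_clock hs, h.strictMonoOn_gamma.lt_iff_lt hr (h.clock_mem hs v)]

lemma clock_lt_iff (h : IsCoefficients T α β γ) (hs : 0 ≤ s) {v : ℝ≥0} {r : ℝ}
    (hr : r ∈ Ico 0 (T : ℝ)) : clock T γ s v < r ↔ s + v < γ r := by
  rw [← h.gamma_clock hs, h.strictMonoOn_gamma.lt_iff_lt (h.clock_mem hs v) hr]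

lemma continuous_clock (h : IsCoefficients T α β γ) (hs : 0 ≤ s) : Continuous (clock T γ s) := by
  rw [continuous_iff_continuousAt]
  intro v
  have hv := h.clock_mem hs v
  refine tendsto_order.2 ⟨fun a ha => ?_, fun a ha => ?_⟩
  · rcases lt_or_ge a 0 with ha0 | ha0
    · exact Eventually.of_forall fun u => ha0.trans_le (h.clock_mem hs u).1
    · have ham : a ∈ Ico 0 (T : ℝ) := ⟨ha0, ha.trans hv.2⟩
      simp only [h.lt_clock_iff hs ham]
      exact (by fun_prop : Continuous fun u : ℝ≥0 => s + (u : ℝ)).continuousAt.eventually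
        (lt_mem_nhds ((h.lt_clock_iff hs ham).1 ha))
  · rcases le_or_gt (T : ℝ) a with ha0 | ha0
    · exact Eventually.of_forall fun u => (h.clock_mem hs u).2.trans_le ha0
    · have ham : a ∈ Ico 0 (T : ℝ) := ⟨hv.1.trans ha.le, ha0⟩
      simp only [h.clock_lt_iff hs ham]
      exact (by fun_prop : Continuous fun u : ℝ≥0 => s + (u : ℝ)).continuousAt.eventually
        (gt_mem_nhds ((h.clock_lt_iff hs ham).1 ha))

lemma tendsto_clock (h : IsCoefficients T α β γ) (hs : 0 ≤ s) :
    Tendsto (clock T γ s) atTop (𝓝[<] (T : ℝ)) := by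
  refine tendsto_nhdsWithin_iff.2 ⟨tendsto_order.2 ⟨fun a ha => ?_, fun a ha => ?_⟩,
    Eventually.of_forall fun u => (h.clock_mem hs u).2⟩
  · rcases lt_or_ge a 0 with ha0 | ha0
    · exact Eventually.of_forall fun u => ha0.trans_le (h.clock_mem hs u).1
    · simp only [h.lt_clock_iff hs ⟨ha0, ha⟩]
      exact (tendsto_atTop_add_const_left _ s (NNReal.tendsto_coe_atTop.2 tendsto_id)).eventually
        (eventually_gt_atTop _)
  · exact Eventually.of_forall fun u => (h.clock_mem hs u).2.trans ha

lemma continuous_alpha_clock (h : IsCoefficients T α β γ) (hs : 0 ≤ s) :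
    Continuous fun v => α (clock T γ s v) :=
  h.contDiffOn_alpha.continuousOn.comp_continuous (h.continuous_clock hs) (h.clock_mem_Icc hs)

lemma continuous_beta_clock (h : IsCoefficients T α β γ) (hs : 0 ≤ s) :
    Continuous fun v => β (clock T γ s v) :=
  h.contDiffOn_beta.continuousOn.comp_continuous (h.continuous_clock hs) (h.clock_mem_Icc hs)

lemma tendsto_comp_clock (h : IsCoefficients T α β γ) (hs : 0 ≤ s) {f : ℝ → ℝ}
    (hf : ContinuousOn f (Icc 0 (T : ℝ))) :
    Tendsto (fun v => f (clock T γ s v)) atTop (𝓝 (f T)) := by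
  refine (hf T ⟨T.2, le_rfl⟩).tendsto.comp (tendsto_nhdsWithin_iff.2
    ⟨(h.tendsto_clock hs).mono_right nhdsWithin_le_nhds, Eventually.of_forall (h.clock_mem_Icc hs)⟩)

lemma gain_eq (v : ℝ≥0) (b : ℝ) :
    gain T z α β γ (s + v) b =
      α (clock T γ s v) + β (clock T γ s v) * ((z - α T) * (s + v) + b) := rfl

lemma tendsto_beta_clock_mul (h : IsCoefficients T α β γ) (hs : 0 ≤ s) :
    Tendsto (fun v : ℝ≥0 => β (clock T γ s v) * (s + v)) atTop (𝓝 1) := by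
  refine (h.tendsto_beta_mul_gamma.comp (h.tendsto_clock hs)).congr fun v => ?_
  simp only [Function.comp, h.gamma_clock hs]

lemma tendsto_beta_clock (h : IsCoefficients T α β γ) (hs : 0 ≤ s) :
    Tendsto (fun v : ℝ≥0 => β (clock T γ s v)) atTop (𝓝 0) := by
  simpa [h.beta_horizon] using h.tendsto_comp_clock hs h.contDiffOn_beta.continuousOn

lemma tendsto_beta_clock_mul_one_add (h : IsCoefficients T α β γ) (hs : 0 ≤ s) :
    Tendsto (fun v : ℝ≥0 => β (clock T γ s v) * (1 + v)) atTop (𝓝 1) := by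
  have h1 := (h.tendsto_beta_clock_mul hs).add ((h.tendsto_beta_clock hs).mul_const (1 - s))
  rw [zero_mul, add_zero] at h1
  exact h1.congr fun v => by ring

lemma continuous_gain (h : IsCoefficients T α β γ) (hs : 0 ≤ s) :
    Continuous fun p : ℝ≥0 × ℝ => gain T z α β γ (s + p.1) (y + p.2) := by
  simp only [gain_eq]
  have h1 := (h.continuous_alpha_clock hs).comp (continuous_fst (X := ℝ≥0) (Y := ℝ))
  have h2 := (h.continuous_beta_clock hs).comp (continuous_fst (X := ℝ≥0) (Y := ℝ))
  exact h1.add (h2.mul (by fun_prop))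

/-- Isolates the randomness as `b / (1 + v)`, the quantity handled by the law of large numbers and
the growth bound. Its weight is continuous and tends to `1`, because `β γ → 1`. -/
lemma gain_decomp (v : ℝ≥0) (b : ℝ) :
    gain T z α β γ (s + v) (y + b) =
      gain T z α β γ (s + v) y + (β (clock T γ s v) * (1 + v)) * (b / (1 + v)) := by
  have : (1 + (v : ℝ)) ≠ 0 := by positivity
  simp only [gain_eq]
  field_simp
  ring

lemma tendsto_gain_const (h : IsCoefficients T α β γ) (hs : 0 ≤ s) :
    Tendsto (fun v : ℝ≥0 => gain T z α β γ (s + v) y) atTop (𝓝 z) := by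
  have h1 := ((h.tendsto_comp_clock hs h.contDiffOn_alpha.continuousOn).add
    ((h.tendsto_beta_clock_mul hs).const_mul (z - α T))).add
    ((h.tendsto_beta_clock hs).mul_const y)
  have e : α T + (z - α T) * 1 + 0 * y = z := by ring
  rw [e] at h1
  refine h1.congr fun v => ?_
  rw [gain_eq]
  ring

lemma tendsto_gain (h : IsCoefficients T α β γ) (hs : 0 ≤ s) {b : ℝ≥0 → ℝ}
    (hb : Tendsto (fun u : ℝ≥0 => b u / (1 + u)) atTop (𝓝 0)) :
    Tendsto (fun u : ℝ≥0 => gain T z α β γ (s + u) (y + b u)) atTop (𝓝 z) := by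
  have h1 := (h.tendsto_gain_const (z := z) (y := y) hs).add
    ((h.tendsto_beta_clock_mul_one_add hs).mul hb)
  simpa [gain_decomp] using h1

lemma exists_abs_gain_le (h : IsCoefficients T α β γ) (hs : 0 ≤ s) :
    ∃ C, ∀ (u : ℝ≥0) (b : ℝ), |gain T z α β γ (s + u) (y + b)| ≤ C * (1 + |b| / (1 + u)) := by
  have hc : Continuous fun v : ℝ≥0 => gain T z α β γ (s + v) y := by
    simpa [Function.comp_def] using (h.continuous_gain (z := z) (y := y) hs).comp
      (continuous_id.prodMk (continuous_const (y := (0 : ℝ))))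
  have hc' : Continuous fun v : ℝ≥0 => β (clock T γ s v) * (1 + v) :=
    (h.continuous_beta_clock hs).mul (by fun_prop)
  obtain ⟨C₁, h₁⟩ := exists_abs_le_of_tendsto hc (h.tendsto_gain_const hs)
  obtain ⟨C₂, h₂⟩ := exists_abs_le_of_tendsto hc' (h.tendsto_beta_clock_mul_one_add hs)
  refine ⟨max C₁ C₂, fun u b => ?_⟩
  have hu : (0 : ℝ) < 1 + u := by positivity
  rw [gain_decomp]
  calc _ ≤ C₁ + C₂ * (|b| / (1 + u)) := by
        refine (abs_add_le _ _).trans (add_le_add (h₁ u) ?_)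
        rw [abs_mul, abs_div, abs_of_pos hu]
        gcongr
        exact h₂ u
    _ ≤ max C₁ C₂ * 1 + max C₁ C₂ * (|b| / (1 + u)) := by
        gcongr
        · rw [mul_one]; exact le_max_left _ _
        · exact le_max_right _ _
    _ = _ := by ring

end IsCoefficients

/-! ### From almost every starting point to every starting point. -/

/-- A weakly continuous family of probability measures that integrates, over all measurable sets
of parameters, like a constant measure is constant. -/
lemma eq_of_weakly_continuous {E : Type*} [MetricSpace E] [MeasurableSpace E] [BorelSpace E]
    {ν : ℝ → Measure E} [∀ x, IsProbabilityMeasure (ν x)] {π : Measure E} [IsProbabilityMeasure π]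
    {μ : Measure ℝ} [IsFiniteMeasure μ] (hμ : volume ≪ μ)
    (hν : ∀ f : BoundedContinuousFunction E ℝ, Continuous fun x => ∫ e, f e ∂(ν x))
    (hint : ∀ U : Set E, IsOpen U → ∀ C : Set ℝ, MeasurableSet C →
      ∫⁻ x in C, ν x U ∂μ = π U * μ C) (x : ℝ) : ν x = π := by
  have hle : ∀ U : Set E, IsOpen U → ν x U ≤ π U := by
    intro U hU
    -- By the portmanteau theorem for open sets. Semicontinuity also supplies the measurability in
    -- `x` needed for the almost everywhere identification.
    have hlsc : LowerSemicontinuous fun x => ν x U := by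
      rw [lowerSemicontinuous_iff_le_liminf]
      intro x₀
      let N : ℝ → ProbabilityMeasure E := fun x => ⟨ν x, inferInstance⟩
      have ht : Tendsto N (𝓝 x₀) (𝓝 (N x₀)) :=
        ProbabilityMeasure.tendsto_iff_forall_integral_tendsto.2 fun f => (hν f).tendsto x₀
      exact ProbabilityMeasure.le_liminf_measure_open_of_tendsto ht hU
    have hae : (fun x => ν x U) =ᵐ[μ] fun _ => π U :=
      ae_eq_of_forall_setLIntegral_eq_of_sigmaFinite hlsc.measurable measurable_const
        fun C hC _ => by rw [hint U hU C hC, setLIntegral_const]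
    -- A set of full Lebesgue measure is dense, so a strict excess at one `x`, which persists
    -- nearby, would meet a point of equality.
    have hd : Dense {x | ν x U = π U} := Measure.dense_of_ae (μ := volume) (hμ.ae_le hae)
    by_contra! hlt
    obtain ⟨x', hx', hx''⟩ := hd.inter_nhds_nonempty (hlsc x _ hlt)
    exact (show π U < ν x' U from hx'').ne' hx'
  -- Outer regularity of `π` extends the inequality from open to measurable sets; equal total masses
  -- then force equality.
  refine Measure.eq_of_le_of_isProbabilityMeasure (Measure.le_iff.2 fun A _ => ?_)
  rw [A.measure_eq_iInf_isOpen π]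
  exact le_iInf₂ fun U hAU => le_iInf fun hU => (measure_mono hAU).trans (hle U hU)

/-! ### The recovered process is a Brownian motion under `P t x`. -/

/-- The Brownian motion recovered from the bridge `X` by inverting the time-space transformation.
-/
noncomputable def drive {Ω : Type*} (T : ℝ≥0) (z : ℝ) (α β γ : ℝ → ℝ) (X : ℝ≥0 → Ω → ℝ) (s y : ℝ)
    (v : ℝ≥0) (ω : Ω) : ℝ :=
  (X (clock T γ s v).toNNReal ω - α (clock T γ s v)) / β (clock T γ s v) - (z - α T) * (s + v) - y

section

variable {T : ℝ≥0} {α β γ : ℝ → ℝ} {z s y : ℝ} {t : ℝ≥0}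

namespace IsCoefficients

lemma gamma_coe_nonneg (h : IsCoefficients T α β γ) (ht : t < T) : 0 ≤ γ t :=
  h.gamma_nonneg ⟨t.2, ht⟩

lemma clock_toNNReal_mem (h : IsCoefficients T α β γ) (ht : t < T) (v : ℝ≥0) :
    (clock T γ (γ t) v).toNNReal ∈ Icc t T := by
  have hs := h.gamma_coe_nonneg ht
  have h0 : clock T γ (γ t) 0 = t := h.clock_eq hs ⟨t.2, ht⟩ (by simp)
  have h1 := (h.strictMono_clock hs).monotone (zero_le (a := v))
  rw [h0] at h1
  exact ⟨NNReal.le_toNNReal_of_coe_le h1, Real.toNNReal_le_iff_le_coe.2 (h.clock_mem hs v).2.le⟩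

lemma clock_zero (h : IsCoefficients T α β γ) (ht : t < T) : clock T γ (γ t) 0 = t :=
  h.clock_eq (h.gamma_coe_nonneg ht) ⟨t.2, ht⟩ (by simp)

end IsCoefficients

/-- The increments from time `0` of the recovered Brownian motion at the times in `I`, as functions
of the path of the bridge on `[t, T]`. -/
noncomputable def increments (T : ℝ≥0) (z : ℝ) (α β γ : ℝ → ℝ) (s : ℝ) (I : Finset ℝ≥0)
    (p : ℝ≥0 → ℝ) (v : I) : ℝ :=
  drive T z α β γ (fun u (p : ℝ≥0 → ℝ) => p u) s 0 v p -
    drive T z α β γ (fun u (p : ℝ≥0 → ℝ) => p u) s 0 0 p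

open Classical in
/-- Extension of a function on a set of times by zero. -/
noncomputable def extendZero (S : Set ℝ≥0) (p : S → ℝ) (u : ℝ≥0) : ℝ :=
  if h : u ∈ S then p ⟨u, h⟩ else 0

lemma extendZero_of_mem {S : Set ℝ≥0} (p : S → ℝ) {u : ℝ≥0} (h : u ∈ S) :
    extendZero S p u = p ⟨u, h⟩ := dif_pos h

variable {Ω : Type*} [MeasurableSpace Ω] {X : ℝ≥0 → Ω → ℝ} {P : ℝ≥0 → ℝ → Measure Ω}

lemma measurable_increments (hX : ∀ u, Measurable (X u)) (I : Finset ℝ≥0) :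
    Measurable fun ω => increments T z α β γ s I fun u => X u ω := by
  unfold increments drive
  fun_prop

/-- A single null set serves all `s` and `v`. The additive constant disappears on taking increments.
-/
lemma IsBridge.exists_drive_eq (h : IsCoefficients T α β γ) {x₀ : ℝ} {μ : Measure Ω}
    (hb : IsBridge T z α β γ x₀ X μ) : ∃ W : ℝ≥0 → Ω → ℝ, IsBrownianReal W μ ∧
      ∀ᵐ ω ∂μ, ∀ (s v : ℝ≥0), drive T z α β γ X s 0 v ω = W (s + v) ω + (x₀ - α 0) / β 0 := by
  obtain ⟨W, hW, hae⟩ := hb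
  refine ⟨W, hW, ?_⟩
  filter_upwards [hae] with ω hω s v
  have hm := h.clock_mem s.coe_nonneg v
  have hβ := (h.beta_pos _ hm).ne'
  have hc : (((clock T γ s v).toNNReal : ℝ≥0) : ℝ) = clock T γ s v := Real.coe_toNNReal _ hm.1
  have hlt : (clock T γ s v).toNNReal < T := by
    rw [← NNReal.coe_lt_coe, hc]; exact hm.2
  have hg : γ (clock T γ s v) = ((s + v : ℝ≥0) : ℝ) := by rw [h.gamma_clock s.coe_nonneg]; simp
  rw [drive, hω.1 _ hlt, hc, hg, Real.toNNReal_coe]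
  push_cast
  field_simp
  ring

/-- Under the law of the bridge started at time `0`, the increments after time `t` of the driving
Brownian motion are independent of `X t`. -/
lemma IsBridge.measure_increments (h : IsCoefficients T α β γ) {x₀ : ℝ} {μ : Measure Ω}
    (hb : IsBridge T z α β γ x₀ X μ) (ht : t < T) {C : Set ℝ}
    (hC : MeasurableSet C) (I : Finset ℝ≥0) {A : Set (I → ℝ)} (hA : MeasurableSet A) :
    μ {ω | X t ω ∈ C ∧ increments T z α β γ (γ t) I (fun u => X u ω) ∈ A} =
      BrownianReal.projectiveFamily I A * μ {ω | X t ω ∈ C} := by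
  obtain ⟨W, hW, hae⟩ := hb.exists_drive_eq h
  have hs := h.gamma_coe_nonneg ht
  set s : ℝ≥0 := (γ t).toNNReal
  have hsc : ((s : ℝ≥0) : ℝ) = γ t := Real.coe_toNNReal _ hs
  -- Weak Markov property: the shifted increments are independent of the path up to `s`, and `X t`
  -- is almost surely an affine function of `W s`.
  have hind := hW.toIsPreBrownianReal.indepFun_shift s
  have hinc : ∀ᵐ ω ∂μ, increments T z α β γ (γ t) I (fun u => X u ω) =
      I.restrict fun v => W (s + v) ω - W s ω := by
    filter_upwards [hae] with ω hω
    have h0 := hω s 0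
    rw [add_zero, hsc] at h0
    funext v
    have hv := hω s v
    rw [hsc] at hv
    change drive T z α β γ X (γ t) 0 v ω - drive T z α β γ X (γ t) 0 0 ω = _
    rw [hv, h0]
    simp
  have hXt : ∀ᵐ ω ∂μ, X t ω =
      α t + β t * (W s ω + (x₀ - α 0) / β 0 + (z - α T) * γ t) := by
    filter_upwards [hae] with ω hω
    have h0 := hω s 0
    have hβ := (h.beta_pos t ⟨t.2, ht⟩).ne'
    rw [add_zero, hsc, drive, h.clock_zero ht, Real.toNNReal_coe] at h0
    rw [← h0]
    simp only [NNReal.coe_zero, add_zero, sub_zero]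
    field_simp
    ring
  set k : ℝ → ℝ := fun w => α t + β t * (w + (x₀ - α 0) / β 0 + (z - α T) * γ t)
  have hk : Measurable k := by fun_prop
  have hind' : IndepFun (fun ω => I.restrict fun v => W (s + v) ω - W s ω) (fun ω => k (W s ω)) μ :=
    hind.comp (φ := fun f : ℝ≥0 → ℝ => I.restrict f) (ψ := fun f : Iic s → ℝ => k (f ⟨s, mem_Iic.2 le_rfl⟩))
      (Finset.measurable_restrict I) (hk.comp (measurable_pi_apply _))
  have e1 : μ {ω | X t ω ∈ C ∧ increments T z α β γ (γ t) I (fun u => X u ω) ∈ A} =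
      μ ((fun ω => I.restrict fun v => W (s + v) ω - W s ω) ⁻¹' A ∩ (fun ω => k (W s ω)) ⁻¹' C) := by
    refine measure_congr ?_
    filter_upwards [hinc, hXt] with ω h1 h2
    refine propext ?_
    change (X t ω ∈ C ∧ _ ∈ A) ↔ (_ ∈ A ∧ k (W s ω) ∈ C)
    rw [h1, h2, and_comm]
  have e2 : μ {ω | X t ω ∈ C} = μ ((fun ω => k (W s ω)) ⁻¹' C) := by
    refine measure_congr ?_
    filter_upwards [hXt] with ω h2
    refine propext ?_
    change X t ω ∈ C ↔ k (W s ω) ∈ C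
    rw [h2]
  have hlaw := (hW.shift s).hasLaw I
  rw [e1, e2, hind'.measure_inter_preimage_eq_mul _ _ hA hC, ← hlaw.map_eq,
    Measure.map_apply_of_aemeasurable hlaw.aemeasurable hA]

/-- For `t > 0` the law of `X t` is Gaussian with variance `β t ^ 2 * γ t > 0`, so null sets of
starting points are Lebesgue null. -/
lemma IsBridge.volume_absolutelyContinuous (h : IsCoefficients T α β γ) {x₀ : ℝ} {μ : Measure Ω}
    (hb : IsBridge T z α β γ x₀ X μ) (h0 : 0 < t) (ht : t < T) :
    volume ≪ μ.map (X t) := by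
  obtain ⟨W, hW, hae⟩ := hb
  have hs : 0 < γ t := by
    rw [← h.gamma_zero]
    exact h.strictMonoOn_gamma ⟨le_rfl, h.horizon_pos⟩ ⟨t.2, ht⟩ h0
  have hβ := h.beta_pos t ⟨t.2, ht⟩
  have hlaw := gaussianReal_add_const (gaussianReal_const_mul
    (gaussianReal_add_const (hW.hasLaw_eval (γ t).toNNReal)
      ((z - α T) * γ t + (x₀ - α 0) / β 0)) (β t)) (α t)
  have hlaw' := hlaw.congr (Y := X t) (by
    filter_upwards [hae] with ω hω
    rw [hω.1 t ht]
    ring)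
  rw [hlaw'.map_eq]
  refine gaussianReal_absolutelyContinuous' _ ?_
  refine mul_ne_zero (fun hz => ?_) (Real.toNNReal_pos.2 hs).ne'
  have : β t ^ 2 = 0 := congrArg NNReal.toReal hz
  exact hβ.ne' (pow_eq_zero_iff two_ne_zero |>.1 this)

/-- The increments of the recovered process have the finite-dimensional laws of Brownian motion. -/
lemma IsBridgeFamily.map_increments (h : IsCoefficients T α β γ)
    (hX : IsBridgeFamily T z α β γ X P) (ht : t < T) (I : Finset ℝ≥0) (x : ℝ) :
    (P t x).map (fun ω => increments T z α β γ (γ t) I fun u => X u ω) =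
      BrownianReal.projectiveFamily I := by
  have hm := measurable_increments (T := T) (z := z) (α := α) (β := β) (γ := γ) (s := γ t)
    hX.measurable I
  -- At `t = 0` the law of `X t` is a point mass and the density argument fails, but there `P 0 x`
  -- is itself the law of a bridge.
  rcases eq_zero_or_pos t with rfl | h0
  · have := hX.isProbabilityMeasure 0 ht x
    ext A hA
    have := (hX.bridge x).measure_increments h ht MeasurableSet.univ I hA
    simp only [mem_univ, true_and, ofPred_true, measure_univ, mul_one] at this
    rw [Measure.map_apply hm hA]
    exact this
  have hprob : ∀ x, IsProbabilityMeasure (P t x) := hX.isProbabilityMeasure t ht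
  have hprob0 : IsProbabilityMeasure (P 0 0) := hX.isProbabilityMeasure 0 (h0.trans ht) 0
  have : ∀ x, IsProbabilityMeasure
      ((P t x).map (fun ω => increments T z α β γ (γ t) I fun u => X u ω)) :=
    fun x => Measure.isProbabilityMeasure_map hm.aemeasurable
  have : IsProbabilityMeasure ((P 0 0).map (X t)) :=
    Measure.isProbabilityMeasure_map (hX.measurable t).aemeasurable
  have hmem : ∀ v, (clock T γ (γ t) v).toNNReal ∈ Icc t T := h.clock_toNNReal_mem ht
  -- `increments` involves neither `x` nor `y`, so one functional of the path serves all starting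
  -- points. The initial point `0` of the unconditioned bridge is an arbitrary choice.
  refine eq_of_weakly_continuous
    (ν := fun x => (P t x).map fun ω => increments T z α β γ (γ t) I fun u => X u ω)
    ((hX.bridge 0).volume_absolutelyContinuous h h0 ht)
    (fun f => ?_) (fun U hU C hC => ?_) x
  · set J : Finset (Icc t T) := (insert 0 I).image fun v => ⟨_, hmem v⟩
    have hJm : ∀ v ∈ insert 0 I, (⟨_, hmem v⟩ : Icc t T) ∈ J := fun v hv =>
      Finset.mem_image_of_mem _ hv
    set F : (J → ℝ) → I → ℝ := fun q v =>
      ((q ⟨_, hJm v (Finset.mem_insert_of_mem v.2)⟩ - α (clock T γ (γ t) v)) /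
        β (clock T γ (γ t) v) - (z - α T) * (γ t + v) - 0) -
      ((q ⟨_, hJm 0 (Finset.mem_insert_self _ _)⟩ - α (clock T γ (γ t) 0)) /
        β (clock T γ (γ t) 0) - (z - α T) * (γ t + (0 : ℝ≥0)) - 0)
    have hF : Continuous F := by fun_prop
    have hc := hX.weakly_continuous t ht J (f.compContinuous ⟨F, hF⟩)
    refine hc.congr fun x => ?_
    rw [integral_map hm.aemeasurable f.continuous.aestronglyMeasurable]
    rfl
  · have h1 := hX.conditional_law t ht 0 C hC
      {p | increments T z α β γ (γ t) I (extendZero (Icc t T) p) ∈ U} ?_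
    · have hext : ∀ ω, increments T z α β γ (γ t) I
          (extendZero (Icc t T) fun u : Icc t T => X u ω) =
          increments T z α β γ (γ t) I fun u => X u ω := by
        intro ω
        funext v
        simp only [increments, drive, extendZero_of_mem _ (hmem _)]
      simp only [mem_ofPred_eq, hext] at h1
      rw [(hX.bridge 0).measure_increments h ht hC I hU.measurableSet] at h1
      rw [Measure.map_apply (hX.measurable t) hC]
      simp only [Measure.map_apply hm hU.measurableSet]
      exact h1.symm
    · refine (?_ : Measurable fun p : Icc t T → ℝ => increments T z α β γ (γ t) I
        (extendZero (Icc t T) p)) hU.measurableSet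
      refine measurable_pi_lambda _ fun v => ?_
      simp only [increments, drive, extendZero_of_mem _ (hmem _)]
      fun_prop

lemma measurable_drive (hX : ∀ u, Measurable (X u)) (v : ℝ≥0) :
    Measurable (drive T z α β γ X s y v) := by
  unfold drive
  fun_prop

/-- Under `P t x` the recovered process is a standard Brownian motion. -/
lemma IsBridgeFamily.isBrownianReal_drive (h : IsCoefficients T α β γ)
    (hX : IsBridgeFamily T z α β γ X P) (ht : t < T) (x : ℝ)
    (hy : y = (x - α t) / β t - γ t * (z - α T)) :
    IsBrownianReal (drive T z α β γ X (γ t) y) (P t x) where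
  hasLaw I := by
    have hm := measurable_increments (T := T) (z := z) (α := α) (β := β) (γ := γ) (s := γ t)
      hX.measurable I
    refine HasLaw.congr ⟨hm.aemeasurable, hX.map_increments h ht I x⟩ ?_
    -- Almost surely `X t = x`, and `y` is exactly the value that makes the recovered process start
    -- at `0`.
    filter_upwards [hX.start t ht x] with ω hω
    funext v
    change drive T z α β γ X (γ t) y v ω =
      drive T z α β γ X (γ t) 0 v ω - drive T z α β γ X (γ t) 0 0 ω
    simp only [drive, h.clock_zero ht, Real.toNNReal_coe, hω, hy, NNReal.coe_zero]
    ring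
  cont := by
    filter_upwards [hX.continuous_paths t ht x] with ω hω
    have hs := h.gamma_coe_nonneg ht
    have h1 : Continuous fun v => X (clock T γ (γ t) v).toNNReal ω :=
      hω.comp_continuous (continuous_real_toNNReal.comp (h.continuous_clock hs))
        (h.clock_toNNReal_mem ht)
    exact (((h1.sub (h.continuous_alpha_clock hs)).div (h.continuous_beta_clock hs) fun v =>
      (h.beta_pos _ (h.clock_mem hs v)).ne').sub (by fun_prop)).sub continuous_const

end

/-! ### The clock change between the two stopping problems. -/

section

variable {T : ℝ≥0} {α β γ : ℝ → ℝ} {z y : ℝ} {t : ℝ≥0} {Ω : Type*} {X : ℝ≥0 → Ω → ℝ}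

lemma gain_drive (h : IsCoefficients T α β γ) (ht : t < T) (v : ℝ≥0) (ω : Ω) :
    gain T z α β γ (γ t + v) (y + drive T z α β γ X (γ t) y v ω) =
      X (clock T γ (γ t) v).toNNReal ω := by
  have hβ := (h.beta_pos _ (h.clock_mem (h.gamma_coe_nonneg ht) v)).ne'
  rw [IsCoefficients.gain_eq, drive]
  field_simp
  ring

/-- The running time of the clock between `t` and `t + u`. -/
noncomputable def elapsed (γ : ℝ → ℝ) (t u : ℝ≥0) : ℝ≥0 := (γ (t + u) - γ t).toNNReal

namespace IsCoefficients

lemma mem_Ico_add {u : ℝ≥0} (hu : t + u < T) : (t + u : ℝ) ∈ Ico 0 (T : ℝ) :=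
  ⟨by positivity, by exact_mod_cast hu⟩

lemma add_elapsed (h : IsCoefficients T α β γ) {u : ℝ≥0} (hu : t + u < T) :
    γ t + elapsed γ t u = γ (t + u) := by
  have : γ t ≤ γ (t + u) := h.strictMonoOn_gamma.monotoneOn
    ⟨t.2, NNReal.coe_lt_coe.2 (lt_of_le_of_lt le_self_add hu)⟩ (mem_Ico_add hu) (by simp)
  rw [elapsed, Real.coe_toNNReal _ (sub_nonneg.2 this)]
  ring

lemma toNNReal_clock_of_eq (h : IsCoefficients T α β γ) (ht : t < T) {u v : ℝ≥0}
    (hu : t + u < T) (hv : γ t + v = γ (t + u)) : (clock T γ (γ t) v).toNNReal = t + u := by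
  rw [h.clock_eq (h.gamma_coe_nonneg ht) (mem_Ico_add hu) hv.symm]
  exact_mod_cast Real.toNNReal_coe

lemma exists_clock_eq (h : IsCoefficients T α β γ) (ht : t < T) (v : ℝ≥0) :
    ∃ u : ℝ≥0, t + u < T ∧ γ t + v = γ (t + u) := by
  have hs := h.gamma_coe_nonneg ht
  have hm := h.clock_mem hs v
  obtain ⟨u, hu⟩ := exists_add_of_le (h.clock_toNNReal_mem ht v).1
  have hu' : (t + u : ℝ) = clock T γ (γ t) v := by
    rw [← Real.coe_toNNReal _ hm.1, hu]; simp
  refine ⟨u, ?_, ?_⟩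
  · rw [← NNReal.coe_lt_coe]; push_cast; rw [hu']; exact hm.2
  · rw [hu', h.gamma_clock hs]

lemma le_iff_of_eq (h : IsCoefficients T α β γ) {u u' v v' : ℝ≥0} (hu : t + u < T)
    (hu' : t + u' < T) (hv : γ t + v = γ (t + u)) (hv' : γ t + v' = γ (t + u')) :
    u ≤ u' ↔ v ≤ v' := by
  have h1 := h.strictMonoOn_gamma.le_iff_le (mem_Ico_add hu) (mem_Ico_add hu')
  rw [← hv, ← hv', add_le_add_iff_left, add_le_add_iff_left] at h1
  exact_mod_cast h1.symm

end IsCoefficients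

/-- The bridge is a deterministic transformation of the recovered process. -/
lemma bridge_eq_gain_drive (h : IsCoefficients T α β γ) (ht : t < T) {u v : ℝ≥0}
    (hu : t + u < T) (hv : γ t + v = γ (t + u)) (ω : Ω) :
    X (t + u) ω = gain T z α β γ (γ t + v) (y + drive T z α β γ X (γ t) y v ω) := by
  rw [gain_drive h ht, h.toNNReal_clock_of_eq ht hu hv]

lemma exists_timeLinked_right (h : IsCoefficients T α β γ) (τ : Ω → ℝ≥0) :
    ∃ σ, TimeLinked T γ t (γ t) τ σ := by
  classical
  refine ⟨fun ω => if t + τ ω < T then (elapsed γ t (τ ω) : WithTop ℝ≥0) else ⊤, fun ω =>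
    ⟨fun hω => ⟨elapsed γ t (τ ω), if_pos hω, h.add_elapsed hω⟩, fun hω => if_neg hω.not_lt⟩⟩

lemma exists_timeLinked_left (h : IsCoefficients T α β γ) (ht : t < T) (σ : Ω → WithTop ℝ≥0) :
    ∃ τ, (∀ ω, t + τ ω ≤ T) ∧ TimeLinked T γ t (γ t) τ σ := by
  have : ∀ ω, ∃ u : ℝ≥0, t + u ≤ T ∧
      (t + u < T → ∃ r : ℝ≥0, σ ω = r ∧ γ t + r = γ (t + u)) ∧ (t + u = T → σ ω = ⊤) := by
    intro ω
    rcases hσ : σ ω with _ | r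
    · have e : t + (T - t) = T := add_tsub_cancel_of_le ht.le
      exact ⟨T - t, e.le, fun hlt => absurd e hlt.ne, fun _ => rfl⟩
    · obtain ⟨u, hu, hr⟩ := h.exists_clock_eq ht r
      exact ⟨u, hu.le, fun _ => ⟨r, rfl, hr⟩, fun he => absurd he hu.ne⟩
  choose τ h1 h2 using this
  exact ⟨τ, h1, h2⟩

/-- Linked random times yield the same gain. -/
lemma bridge_eq_stoppedGain (h : IsCoefficients T α β γ) (ht : t < T) {τ : Ω → ℝ≥0}
    {σ : Ω → WithTop ℝ≥0} (hτ : ∀ ω, t + τ ω ≤ T) (hl : TimeLinked T γ t (γ t) τ σ) {ω : Ω}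
    (hc : ContinuousOn (fun u => X u ω) (Icc t T)) :
    X (t + τ ω) ω = stoppedGain (gain T z α β γ) (γ t) y (drive T z α β γ X (γ t) y) σ ω := by
  rcases (hτ ω).lt_or_eq with hlt | heq
  · obtain ⟨r, hr, hr'⟩ := (hl ω).1 hlt
    simp only [stoppedGain, hr, WithTop.coe_ne_top, if_false, WithTop.untopD_coe]
    exact bridge_eq_gain_drive h ht hlt hr' ω
  · simp only [stoppedGain, (hl ω).2 heq, if_true, gain_drive h ht, heq]
    -- Along the clock the gain equals `X` at times tending to `T`, so path continuity at `T` gives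
    -- the limit `X T`.
    refine (Tendsto.limUnder_eq ?_).symm
    have h1 := (h.tendsto_clock (h.gamma_coe_nonneg ht)).mono_right nhdsWithin_le_nhds
    have h2 := (continuous_real_toNNReal.tendsto (T : ℝ)).comp h1
    rw [Real.toNNReal_coe] at h2
    exact (hc T ⟨ht.le, le_rfl⟩).tendsto.comp (tendsto_nhdsWithin_iff.2
      ⟨h2, Eventually.of_forall (h.clock_toNNReal_mem ht)⟩)

variable [MeasurableSpace Ω]

/-- At linked times each process is a deterministic Borel function of the other, invertible because
`β > 0` before `T`, and the clock preserves order. -/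
lemma natural_bridge_eq (h : IsCoefficients T α β γ) (ht : t < T)
    (hX : ∀ u, StronglyMeasurable (X (t + u)))
    (hB : ∀ v, StronglyMeasurable fun ω => y + drive T z α β γ X (γ t) y v ω) {u v : ℝ≥0}
    (hu : t + u < T) (hv : γ t + v = γ (t + u)) :
    Filtration.natural (fun u => X (t + u)) hX u =
      Filtration.natural (fun v ω => y + drive T z α β γ X (γ t) y v ω) hB v := by
  refine le_antisymm (iSup₂_le fun j hj => Measurable.comap_le ?_)
    (iSup₂_le fun j hj => Measurable.comap_le ?_)
  · have hju : t + j < T := lt_of_le_of_lt (by gcongr) hu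
    have hle : elapsed γ t j ≤ v := (h.le_iff_of_eq hju hu (h.add_elapsed hju) hv).1 hj
    have he : X (t + j) = (fun b => gain T z α β γ (γ t + elapsed γ t j) b) ∘
        fun ω => y + drive T z α β γ X (γ t) y (elapsed γ t j) ω :=
      funext fun ω => bridge_eq_gain_drive h ht hju (h.add_elapsed hju) ω
    beta_reduce
    rw [he]
    refine Measurable.comp (by unfold gain; fun_prop) ?_
    exact (comap_measurable _).mono (le_iSup₂_of_le (f := fun (j : ℝ≥0) (_ : j ≤ v) =>
      MeasurableSpace.comap (fun ω => y + drive T z α β γ X (γ t) y j ω) inferInstance)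
      _ hle le_rfl) le_rfl
  · obtain ⟨i, hi, hij⟩ := h.exists_clock_eq ht j
    have hle : i ≤ u := (h.le_iff_of_eq hi hu hij hv).2 hj
    have he : (fun ω => y + drive T z α β γ X (γ t) y j ω) =
        (fun b => y + ((b - α (clock T γ (γ t) j)) / β (clock T γ (γ t) j) -
          (z - α T) * (γ t + j) - y)) ∘ X (t + i) := by
      funext ω
      simp only [Function.comp, drive, h.toNNReal_clock_of_eq ht hi hij]
    beta_reduce
    rw [he]
    refine Measurable.comp (by fun_prop) ?_
    exact (comap_measurable _).mono (le_iSup₂_of_le (f := fun (j : ℝ≥0) (_ : j ≤ u) =>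
      MeasurableSpace.comap (X (t + j)) inferInstance) _ hle le_rfl) le_rfl

/-- Linked random times are stopping times of the bridge and of the recovered Brownian motion
simultaneously. -/
lemma isAdmissible_iff (h : IsCoefficients T α β γ) (ht : t < T) (hX : ∀ u, Measurable (X u))
    (hB : ∀ v, Measurable (drive T z α β γ X (γ t) y v)) {τ : Ω → ℝ≥0} {σ : Ω → WithTop ℝ≥0}
    (hτ : ∀ ω, t + τ ω ≤ T) (hl : TimeLinked T γ t (γ t) τ σ) :
    IsAdmissible T X hX t τ ↔
      IsBrownianStoppingTime y (drive T z α β γ X (γ t) y) hB σ := by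
  -- Linked times compare with linked deterministic times alike; on `t + τ = T` both events fail,
  -- since `u` lies strictly before the horizon.
  have hset : ∀ u v : ℝ≥0, t + u < T → γ t + v = γ (t + u) →
      {ω | (τ ω : WithTop ℝ≥0) ≤ u} = {ω | σ ω ≤ v} := by
    intro u v hu hv
    ext ω
    simp only [mem_ofPred_eq, WithTop.coe_le_coe]
    rcases (hτ ω).lt_or_eq with hlt | heq
    · obtain ⟨r, hr, hr'⟩ := (hl ω).1 hlt
      rw [hr, WithTop.coe_le_coe]
      exact h.le_iff_of_eq hlt hu hr' hv
    · rw [(hl ω).2 heq]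
      simp only [top_le_iff, WithTop.coe_ne_top, iff_false, not_le]
      rw [← heq] at hu
      exact lt_of_add_lt_add_left hu
  refine ⟨fun hadm r => ?_, fun hst => ⟨fun u => ?_, hτ⟩⟩
  · obtain ⟨u, hu, hr⟩ := h.exists_clock_eq ht r
    have h1 := hadm.1 u
    rwa [hset u r hu hr, natural_bridge_eq h ht _ (fun v => ((hB v).const_add y).stronglyMeasurable)
      hu hr] at h1
  · rcases lt_or_ge (t + u) T with hu | hu
    · rw [hset u _ hu (h.add_elapsed hu), natural_bridge_eq h ht _
        (fun v => ((hB v).const_add y).stronglyMeasurable) hu (h.add_elapsed hu)]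
      exact hst _
    · have : {ω | (τ ω : WithTop ℝ≥0) ≤ u} = univ := eq_univ_of_forall fun ω =>
        WithTop.coe_le_coe.2 (le_of_add_le_add_left ((hτ ω).trans hu))
      rw [this]
      exact @MeasurableSet.univ Ω (Filtration.natural (fun u => X (t + u))
        (fun u => (hX (t + u)).stronglyMeasurable) u)

variable {μ : Measure Ω}

/-- The finite-horizon problem for the bridge and the infinite-horizon problem for the recovered
Brownian motion have the same value. -/
lemma bridgeValue_eq (h : IsCoefficients T α β γ) (ht : t < T) (hX : ∀ u, Measurable (X u))
    (hB : ∀ v, Measurable (drive T z α β γ X (γ t) y v))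
    (hc : ∀ᵐ ω ∂μ, ContinuousOn (fun u => X u ω) (Icc t T)) :
    bridgeValue T X hX t μ =
      brownianValue (gain T z α β γ) (γ t) y (drive T z α β γ X (γ t) y) hB μ := by
  have hint : ∀ (τ : Ω → ℝ≥0) (σ : Ω → WithTop ℝ≥0), (∀ ω, t + τ ω ≤ T) →
      TimeLinked T γ t (γ t) τ σ → ∫ ω, X (t + τ ω) ω ∂μ = ∫ ω, stoppedGain (gain T z α β γ) (γ t) y
        (drive T z α β γ X (γ t) y) σ ω ∂μ := fun τ σ hτ hl => integral_congr_ae <| by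
    filter_upwards [hc] with ω hω using bridge_eq_stoppedGain h ht hτ hl hω
  refine le_antisymm (iSup₂_le fun τ hτ => ?_) (iSup₂_le fun σ hσ => ?_)
  · obtain ⟨σ, hl⟩ := exists_timeLinked_right (t := t) h τ
    rw [hint τ σ hτ.2 hl]
    exact le_iSup₂_of_le σ ((isAdmissible_iff h ht hX hB hτ.2 hl).1 hτ) le_rfl
  · obtain ⟨τ, hτ, hl⟩ := exists_timeLinked_left h ht σ
    rw [← hint τ σ hτ hl]
    exact le_iSup₂_of_le τ ((isAdmissible_iff h ht hX hB hτ hl).2 hσ) le_rfl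

end

end GMB

theorem proposition2
    (T : ℝ≥0) (z : ℝ) (α β γ : ℝ → ℝ) (hcoef : GMB.IsCoefficients T α β γ)
    {Ω : Type*} [MeasurableSpace Ω] (X : ℝ≥0 → Ω → ℝ) (P : ℝ≥0 → ℝ → Measure Ω)
    (hX : GMB.IsBridgeFamily T z α β γ X P)
    (t : ℝ≥0) (ht : t < T) (x s y : ℝ)
    (hs : s = γ t) (hy : y = (x - α t) / β t - γ t * (z - α T)) :
    -- equality of the values, for every Brownian motion on every probability space
    (∀ {Ω' : Type*} [MeasurableSpace Ω'] (B : ℝ≥0 → Ω' → ℝ) (Q : Measure Ω')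
      (hB : ∀ u, Measurable (B u)), IsBrownianReal B Q →
        GMB.bridgeValue T X hX.measurable t (P t x) =
          GMB.brownianValue (GMB.gain T z α β γ) s y B hB Q) ∧
    -- correspondence of the optimal stopping times, for the Brownian motion that drives `X`
    (∃ (B : ℝ≥0 → Ω → ℝ) (hB : ∀ u, Measurable (B u)),
      IsBrownianReal B (P t x) ∧
      (∀ ω, ∀ u : ℝ≥0, t + u < T →
        X (t + u) ω = GMB.gain T z α β γ (γ (t + u)) (y + B (γ (t + u) - s).toNNReal ω)) ∧
      ∀ (τ : Ω → ℝ≥0) (σ : Ω → WithTop ℝ≥0), (∀ ω, t + τ ω ≤ T) →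
        GMB.TimeLinked T γ t s τ σ →
        (GMB.IsOptimalBridge T X hX.measurable t (P t x) τ ↔
          GMB.IsOptimalBrownian (GMB.gain T z α β γ) s y B hB (P t x) σ)) := by
  subst hs
  have hs := hcoef.gamma_coe_nonneg ht
  have hB : ∀ v, Measurable (GMB.drive T z α β γ X (γ t) y v) :=
    fun v => GMB.measurable_drive hX.measurable v
  have hBM := hX.isBrownianReal_drive hcoef ht x hy
  have hc := hX.continuous_paths t ht x
  have hval := GMB.bridgeValue_eq hcoef ht hX.measurable hB hc
  refine ⟨fun B' Q hB' hQ => ?_, _, hB, hBM, fun ω u hu => ?_, fun τ σ hτ hl => ?_⟩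
  · obtain ⟨C, hC⟩ := hcoef.exists_abs_gain_le (z := z) (y := y) hs
    have hg := hcoef.continuous_gain (z := z) (y := y) hs
    rw [hval]
    -- The comparison of two Brownian motions is one-sided, so it is applied in both directions
    -- between `B'` and `drive`.
    exact le_antisymm
      (GMB.brownianValue_le hg hC (fun b => hcoef.tendsto_gain hs) hB' hB hQ hBM)
      (GMB.brownianValue_le hg hC (fun b => hcoef.tendsto_gain hs) hB hB' hBM hQ)
  · rw [← hcoef.add_elapsed hu, add_sub_cancel_left, Real.toNNReal_coe]
    exact GMB.bridge_eq_gain_drive hcoef ht hu (hcoef.add_elapsed hu) ω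
  · rw [GMB.IsOptimalBridge, GMB.IsOptimalBrownian, hval,
      GMB.isAdmissible_iff hcoef ht hX.measurable hB hτ hl,
      integral_congr_ae (hc.mono fun ω hω => GMB.bridge_eq_stoppedGain hcoef ht hτ hl hω)]
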